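/- **Setting.** Let $J,\bar L,d,q\in\mathbb N$, let $\mathcal S=\mathcal X\times\mathcal T\subset\mathbb R^d\times\mathbb R^q$ be compact, and let $\mathcal P$ be a class of joint distributions $P$ of $(Y,X)$, where $Y=(Y_1,\dots,Y_J)$, $Y_j\in\mathbb R^{\bar L}$, and $X\in\mathbb R^d$ has a Lebesgue density $f=f_P$. Under $P$, $(Y_i,X_i)_{i=1}^n$ is an i.i.d. sample from $P$; $\mathbf E$ is expectation under $P$ and $\|\cdot\|$ is the Euclidean norm. A bootstrap sample $(Y_i^*,X_i^*)_{i=1}^n$ is drawn independently with replacement from $(Y_i,X_i)_{i=1}^n$; $P^*$ and $\mathbf E^*$ are probability and expectation with respect to this draw, given the data. For nonnegative $Z_n$, $Z_n^*$ and $b_n>0$: $Z_n=o_P(b_n)$ $\mathcal P$-uniformly if $\limsup_n\sup_{P\in\mathcal P}P\{Z_n>ab_n\}=0$ for all $a>0$; $Z_n=O_P(b_n)$ $\mathcal P$-uniformly if for every $a>0$ there is $M>0$ with $\limsup_n\sup_{P\in\mathcal P}P\{Z_n>Mb_n\}<a$; $Z_n^*=o_{P^*}(b_n)$ $\mathcal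 P$-uniformly if $\limsup_n\sup_{P\in\mathcal P}P\{P^*\{Z_n^*>ab_n\}>a\}=0$ for all $a>0$; $Z_n^*=O_{P^*}(b_n)$ $\mathcal P$-uniformly if for every $a>0$ there is $M>0$ with $\limsup_n\sup_{P\in\mathcal P}P\{P^*\{Z_n^*>Mb_n\}>a\}<a$. (For non-measurable events and variables, probabilities and expectations are outer ones.) Let $h=h_n>0$ be bandwidths and $r_{n,j}$ normalizing sequences; let $\hat v_{\tau,j}(x),\hat\sigma_{\tau,j}(x)$ be real statistics of the sample, and $\hat v^*_{\tau,j}(x),\hat\sigma^*_{\tau,j}(x)$ real statistics of the sample and the bootstrap sample. Let $v_{n,\tau,j}(x)\in\mathbb R$ be nonstochastic and $\beta_{n,x,\tau,j}:\mathbb R^{\bar L}\times\mathbb R^d\to\mathbb R$ measurable; both may depend on $P$. Put $b_{n,ij}(x,\tau)=\beta_{n,x,\tau,j}(Y_{ij},(X_i-x)/h)$, $\hat g_{\tau,j}(x)=\frac1{nh^d}\sum_{i=1}^nb_{n,ij}(x,\tau)$, $\hat g^*_{\tau,j}(x)=\frac1{nh^d}\sum_{i=1}^n\beta_{n,x,\tau,j}(Y^*_{ij},(X^*_i-x)/h)$.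 **Assumptions.** For every $j=1,\dots,J$: (A1) $\sup_{(x,\tau)\in\mathcal S}\Big|r_{n,j}\frac{\hat v_{\tau,j}(x)-v_{n,\tau,j}(x)}{\hat\sigma_{\tau,j}(x)}-\sqrt{nh^d}\{\hat g_{\tau,j}(x)-\mathbf E\hat g_{\tau,j}(x)\}\Big|=o_P(\sqrt{h^d})$, $\mathcal P$-uniformly. (A2) For some compact $\mathcal K_0\subset\mathbb R^d$ not depending on $P$ or $n$, $\beta_{n,x,\tau,j}(y,u)=0$ for all $u\notin\mathcal K_0$, $(x,\tau)\in\mathcal S$, $y$ in the support of $Y_j$, $n\ge1$ and $P\in\mathcal P$. (A6$'$) There are $C_0,\varepsilon_0>0$ such that for all $P\in\mathcal P$, $n\ge1$, $(x,\tau)\in\mathcal S$ and almost every $x'\in x+[-\varepsilon_0,\varepsilon_0]^d$: $\ \mathbf E[\beta_{n,x,\tau,j}(Y_j,u)^2\mid X=x']\,f(x')\le C_0$ for all $u\in\mathcal K_0$. (L) There are $C,\gamma_j>0$ and $s_{1,j}\in\mathbb R$ such that, with $\delta_{n,j}=n^{s_{1,j}}$, for all $P\in\mathcal P$, $n\ge1$,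 $(x_1,\tau_1)\in\mathcal S$ and $\lambda>0$, $$\mathbf E\Big[\sup_{(x_2,\tau_2)\in\mathcal S:\ \|x_1-x_2\|+\|\tau_1-\tau_2\|\le\lambda}\big(b_{n,ij}(x_1,\tau_1)-b_{n,ij}(x_2,\tau_2)\big)^2\Big]\le C\delta_{n,j}^2\lambda^{\gamma_j},$$ and $\limsup_{n}\sup_{P\in\mathcal P}\mathbf E[\sup_{(x,\tau)\in\mathcal S}b_{n,ij}^4(x,\tau)]\le C$. (R) $h=n^{s_2}$ with $s_2\le0$, and $n^{-1/2}h^{-d-\nu}\to0$ for some $\nu>0$. **Lemma 2.** (i) Under these assumptions, for every $j$, $$\sup_{(x,\tau)\in\mathcal S}r_{n,j}\Big|\frac{\hat v_{\tau,j}(x)-v_{n,\tau,j}(x)}{\hat\sigma_{\tau,j}(x)}\Big|=O_P(\sqrt{\log n}),\quad\mathcal P\text{-uniformly}.$$ (ii) Suppose further that for every $j$, $\mathcal P$-uniformly, (B1) $\sup_{(x,\tau)\in\mathcal S}\Big|r_{n,j}\frac{\hat v^*_{\tau,j}(x)-\hat v_{\tau,j}(x)}{\hat\sigma^*_{\tau,j}(x)}-\sqrt{nh^d}\{\hat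 g^*_{\tau,j}(x)-\mathbf E^*\hat g^*_{\tau,j}(x)\}\Big|=o_{P^*}(\sqrt{h^d})$, (B3) $\sup_{(x,\tau)\in\mathcal S}|\hat\sigma^*_{\tau,j}(x)-\hat\sigma_{\tau,j}(x)|=o_{P^*}(1)$. Then for every $j$, $$\sup_{(x,\tau)\in\mathcal S}r_{n,j}\Big|\frac{\hat v^*_{\tau,j}(x)-\hat v_{\tau,j}(x)}{\hat\sigma^*_{\tau,j}(x)}\Big|=O_{P^*}(\sqrt{\log n}),\quad\mathcal P\text{-uniformly}.$$ -/

import Mathlib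

open MeasureTheory ProbabilityTheory Filter Topology
open scoped ENNReal

noncomputable section

/-- `ℝᵏ` with the Euclidean norm. -/
abbrev Euc (k : ℕ) : Type := EuclideanSpace ℝ (Fin k)

/-- The space of one observation `(Y, X)` with `Y = (Y₁, …, Y_J)`, `Y_j ∈ ℝᴸ` and `X ∈ ℝᵈ`. -/
abbrev Obs (J L d : ℕ) : Type := (Fin J → Euc L) × Euc d

/-- The law of a random sample of size `n` from `P`. -/
def sampleLaw {J L d : ℕ} (P : ProbabilityMeasure (Obs J L d)) (n : ℕ) :
    Measure (Fin n → Obs J L d) :=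
  Measure.pi fun _ => (P : Measure (Obs J L d))

/-- The law of the indices in `n` independent draws with replacement from `n` items. For a sample
`w` the bootstrap sample is `w ∘ κ` with `κ` distributed according to this law. -/
def bootLaw (n : ℕ) : Measure (Fin n → Fin n) := uniformOn Set.univ

/-- Outer expectation of a nonnegative, possibly non-measurable variable. -/
def outerExp {α : Type*} [MeasurableSpace α] (μ : Measure α) (Z : α → ℝ≥0∞) : ℝ≥0∞ :=
  ⨅ (g : α → ℝ≥0∞) (_ : Measurable g) (_ : Z ≤ g), ∫⁻ a, g a ∂μ

theorem outerExp_eq_lintegral {α : Type*} [MeasurableSpace α] (μ : Measure α) {Z : α → ℝ≥0∞}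
    (hZ : Measurable Z) : outerExp μ Z = ∫⁻ a, Z a ∂μ :=
  le_antisymm (iInf_le_of_le Z (iInf_le_of_le hZ (iInf_le_of_le le_rfl le_rfl)))
    (le_iInf fun _ => le_iInf fun _ => le_iInf fun hg => lintegral_mono hg)

/-- Supremum over `(x, τ) ∈ S` of a nonnegative function, with values in `[0, ∞]`. -/
def supOn {d q : ℕ} (S : Set (Euc d × Euc q)) (f : Euc d → Euc q → ℝ) : ℝ≥0∞ :=
  ⨆ s ∈ S, ENNReal.ofReal (f s.1 s.2)

/-- `Z_n = o_P(b_n)`, uniformly over the class `𝓜`. -/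
def UnifLittleO {J L d : ℕ} (𝓜 : Set (ProbabilityMeasure (Obs J L d)))
    (Z : (n : ℕ) → ProbabilityMeasure (Obs J L d) → (Fin n → Obs J L d) → ℝ≥0∞)
    (b : ℕ → ℝ) : Prop :=
  ∀ a : ℝ, 0 < a →
    limsup (fun n => ⨆ P ∈ 𝓜, sampleLaw P n {w | ENNReal.ofReal (a * b n) < Z n P w}) atTop = 0

/-- `Z_n = O_P(b_n)`, uniformly over the class `𝓜`. -/
def UnifBigO {J L d : ℕ} (𝓜 : Set (ProbabilityMeasure (Obs J L d)))
    (Z : (n : ℕ) → ProbabilityMeasure (Obs J L d) → (Fin n → Obs J L d) → ℝ≥0∞)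
    (b : ℕ → ℝ) : Prop :=
  ∀ a : ℝ, 0 < a → ∃ M : ℝ, 0 < M ∧
    limsup (fun n => ⨆ P ∈ 𝓜, sampleLaw P n {w | ENNReal.ofReal (M * b n) < Z n P w}) atTop
      < ENNReal.ofReal a

/-- `Z*_n = o_{P*}(b_n)`, uniformly over the class `𝓜`. -/
def BootUnifLittleO {J L d : ℕ} (𝓜 : Set (ProbabilityMeasure (Obs J L d)))
    (Z : (n : ℕ) → ProbabilityMeasure (Obs J L d) → (Fin n → Obs J L d) → (Fin n → Fin n) → ℝ≥0∞)
    (b : ℕ → ℝ) : Prop :=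
  ∀ a : ℝ, 0 < a →
    limsup (fun n => ⨆ P ∈ 𝓜, sampleLaw P n
      {w | ENNReal.ofReal a < bootLaw n {κ | ENNReal.ofReal (a * b n) < Z n P w κ}}) atTop = 0

/-- `Z*_n = O_{P*}(b_n)`, uniformly over the class `𝓜`. -/
def BootUnifBigO {J L d : ℕ} (𝓜 : Set (ProbabilityMeasure (Obs J L d)))
    (Z : (n : ℕ) → ProbabilityMeasure (Obs J L d) → (Fin n → Obs J L d) → (Fin n → Fin n) → ℝ≥0∞)
    (b : ℕ → ℝ) : Prop :=
  ∀ a : ℝ, 0 < a → ∃ M : ℝ, 0 < M ∧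
    limsup (fun n => ⨆ P ∈ 𝓜, sampleLaw P n
      {w | ENNReal.ofReal a < bootLaw n {κ | ENNReal.ofReal (M * b n) < Z n P w κ}}) atTop
      < ENNReal.ofReal a

/-- The type of the maps `β_{n,x,τ,j}(y, u)`, which may depend on `P`. -/
abbrev BetaFun (J L d q : ℕ) : Type :=
  ProbabilityMeasure (Obs J L d) → ℕ → Euc d → Euc q → Fin J → Euc L → Euc d → ℝ

/-- The type of estimators computed from a sample of size `n`, with arguments
`n`, `j`, the sample, `x` and `τ`. -/
abbrev Estimator (J L d q : ℕ) : Type :=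
  (n : ℕ) → Fin J → (Fin n → Obs J L d) → Euc d → Euc q → ℝ

/-- The type of bootstrap statistics, computed from the original sample (first) and the bootstrap
sample (second). -/
abbrev BootEstimator (J L d q : ℕ) : Type :=
  (n : ℕ) → Fin J → (Fin n → Obs J L d) → (Fin n → Obs J L d) → Euc d → Euc q → ℝ

/-- `b_{n,j}(x, τ) = β_{n,x,τ,j}(Y_j, (X - x) / h)` as a function of one observation `z = (Y, X)`. -/
def bFun {J L d q : ℕ} (β : BetaFun J L d q) (h : ℕ → ℝ) (P : ProbabilityMeasure (Obs J L d))
    (n : ℕ) (j : Fin J) (z : Obs J L d) (x : Euc d) (τ : Euc q) : ℝ :=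
  β P n x τ j (z.1 j) ((h n)⁻¹ • (z.2 - x))

/-- `ĝ_{τ,j}(x) = (n hᵈ)⁻¹ ∑ᵢ β_{n,x,τ,j}(Y_{ij}, (Xᵢ - x) / h)`. -/
def gHat {J L d q : ℕ} (β : BetaFun J L d q) (h : ℕ → ℝ) (P : ProbabilityMeasure (Obs J L d))
    (n : ℕ) (j : Fin J) (w : Fin n → Obs J L d) (x : Euc d) (τ : Euc q) : ℝ :=
  (n * h n ^ d)⁻¹ * ∑ i, bFun β h P n j (w i) x τ

/-- Asymptotic linear representation of the estimators `vhat` around `v`. -/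
def AsympLinear {J L d q : ℕ} (𝓜 : Set (ProbabilityMeasure (Obs J L d)))
    (S : Set (Euc d × Euc q)) (h : ℕ → ℝ) (r : ℕ → Fin J → ℝ) (β : BetaFun J L d q)
    (vhat sigmahat : Estimator J L d q)
    (v : ProbabilityMeasure (Obs J L d) → ℕ → Fin J → Euc d → Euc q → ℝ) : Prop :=
  ∀ j, UnifLittleO 𝓜
    (fun n P w => supOn S fun x τ =>
      |r n j * ((vhat n j w x τ - v P n j x τ) / sigmahat n j w x τ) -
        √(n * h n ^ d) * (gHat β h P n j w x τ - ∫ w', gHat β h P n j w' x τ ∂(sampleLaw P n))|)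
    (fun n => √(h n ^ d))

/-- Kernel-type condition: `β_{n,x,τ,j}(y, ·)` vanishes off `K₀` for `y` in the support of `Y_j`. -/
def KernelType {J L d q : ℕ} (𝓜 : Set (ProbabilityMeasure (Obs J L d)))
    (S : Set (Euc d × Euc q)) (β : BetaFun J L d q) (K₀ : Set (Euc d)) : Prop :=
  ∀ P ∈ 𝓜, ∀ n : ℕ, 1 ≤ n → ∀ x τ, (x, τ) ∈ S → ∀ j,
    ∀ y ∈ ((P : Measure (Obs J L d)).map fun z => z.1 j).support, ∀ u ∉ K₀,
      β P n x τ j y u = 0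

/-- Conditional moment condition:
`E[β_{n,x,τ,j}(Y_j, u)² | X = x'] f(x') ≤ C` for `u ∈ K₀`, for almost all `x'` in the cube of
half-width `ε` around `x`, where `f` is the density of `X`. -/
def CondMoment {J L d q : ℕ} (𝓜 : Set (ProbabilityMeasure (Obs J L d)))
    (S : Set (Euc d × Euc q)) (β : BetaFun J L d q) (K₀ : Set (Euc d)) (C ε : ℝ) : Prop :=
  ∀ P ∈ 𝓜, ∀ n : ℕ, 1 ≤ n → ∀ x τ, (x, τ) ∈ S → ∀ j,
    ∀ᵐ x' : Euc d, (∀ l, |x' l - x l| ≤ ε) → ∀ u ∈ K₀,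
      (∫⁻ y, ENNReal.ofReal (β P n x τ j y u ^ 2)
          ∂(condDistrib (fun z : Obs J L d => z.1 j) (fun z => z.2) (P : Measure (Obs J L d)) x')) *
        ((P : Measure (Obs J L d)).map fun z => z.2).rnDeriv volume x' ≤ ENNReal.ofReal C

/-- Local `L₂`-continuity of `b_{n,j}` with constants `C`, `γ` and rate `δ n = n ^ s₁`. -/
def LocalL2Cont {J L d q : ℕ} (𝓜 : Set (ProbabilityMeasure (Obs J L d)))
    (S : Set (Euc d × Euc q)) (h : ℕ → ℝ) (β : BetaFun J L d q) (j : Fin J)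
    (C γ s₁ : ℝ) : Prop :=
  ∀ P ∈ 𝓜, ∀ n : ℕ, 1 ≤ n → ∀ x₁ τ₁, (x₁, τ₁) ∈ S → ∀ lam : ℝ, 0 < lam →
    outerExp (P : Measure (Obs J L d))
      (fun z => supOn {s ∈ S | ‖x₁ - s.1‖ + ‖τ₁ - s.2‖ ≤ lam} fun x₂ τ₂ =>
        (bFun β h P n j z x₁ τ₁ - bFun β h P n j z x₂ τ₂) ^ 2)
      ≤ ENNReal.ofReal (C * ((n : ℝ) ^ s₁) ^ 2 * lam ^ γ)

/-- Uniform convergence rate `√(log n)` of the estimators `vhat`. -/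
def UnifRate {J L d q : ℕ} (𝓜 : Set (ProbabilityMeasure (Obs J L d)))
    (S : Set (Euc d × Euc q)) (r : ℕ → Fin J → ℝ) (vhat sigmahat : Estimator J L d q)
    (v : ProbabilityMeasure (Obs J L d) → ℕ → Fin J → Euc d → Euc q → ℝ) : Prop :=
  ∀ j, UnifBigO 𝓜
    (fun n P w => supOn S fun x τ =>
      r n j * |(vhat n j w x τ - v P n j x τ) / sigmahat n j w x τ|)
    (fun n => √(Real.log n))

/-- Asymptotic linear representation of the bootstrap statistics. -/
def BootAsympLinear {J L d q : ℕ} (𝓜 : Set (ProbabilityMeasure (Obs J L d)))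
    (S : Set (Euc d × Euc q)) (h : ℕ → ℝ) (r : ℕ → Fin J → ℝ) (β : BetaFun J L d q)
    (vhat : Estimator J L d q) (vstar sigmastar : BootEstimator J L d q) : Prop :=
  ∀ j, BootUnifLittleO 𝓜
    (fun n P w κ => supOn S fun x τ =>
      |r n j * ((vstar n j w (w ∘ κ) x τ - vhat n j w x τ) / sigmastar n j w (w ∘ κ) x τ) -
        √(n * h n ^ d) * (gHat β h P n j (w ∘ κ) x τ -
          ∫ κ', gHat β h P n j (w ∘ κ') x τ ∂(bootLaw n))|)
    (fun n => √(h n ^ d))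

/-- Uniform consistency of the bootstrap scale normalization. -/
def BootScale {J L d q : ℕ} (𝓜 : Set (ProbabilityMeasure (Obs J L d)))
    (S : Set (Euc d × Euc q)) (sigmahat : Estimator J L d q)
    (sigmastar : BootEstimator J L d q) : Prop :=
  ∀ j, BootUnifLittleO 𝓜
    (fun n _ w κ => supOn S fun x τ => |sigmastar n j w (w ∘ κ) x τ - sigmahat n j w x τ|)
    (fun _ => 1)

/-- Uniform convergence rate `√(log n)` of the bootstrap statistics. -/
def BootUnifRate {J L d q : ℕ} (𝓜 : Set (ProbabilityMeasure (Obs J L d)))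
    (S : Set (Euc d × Euc q)) (r : ℕ → Fin J → ℝ) (vhat : Estimator J L d q)
    (vstar sigmastar : BootEstimator J L d q) : Prop :=
  ∀ j, BootUnifBigO 𝓜
    (fun n _ w κ => supOn S fun x τ =>
      r n j * |(vstar n j w (w ∘ κ) x τ - vhat n j w x τ) / sigmastar n j w (w ∘ κ) x τ|)
    (fun n => √(Real.log n))

end

/-! Write `R = √(n hᵈ)` and `K = √(log n)`. By the linear representations, with errors `o(√hᵈ)` that
are negligible against `K`, it suffices that the centred sums of `b_{n,j}(x, τ)` over the sample,
and their bootstrap analogues, are `O(K R)` uniformly over the index set. No chaining is needed: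
moment continuity with polynomial rates lets a net of polynomial cardinality do, since the loss `log
n` in the union bound is the rate being proved. The summands are truncated at `T = (n log n)^{1/4}`.
By the fourth moment envelope, some observation exceeds `T` with probability at most `n c / T⁴ = c /
log n`. Chernoff's bound with parameter `K / R` applies because `2 T K ≤ R` for large `n`, a
consequence of `n h^{2d}` growing like a positive power of `n`. The second moments are of order
`hᵈ`, so a deviation `M K R` has probability at most a constant power of `n^{-1}`, which is made to
beat the cardinality of the net by the choice of `M`. Between net points the increments are
dominated by measurable functions `a k` of tiny mean, and sums of these obey the same bound
(`exists_truncation_grid`, `measure_pi_exists_deviation_le`). Given the data, the bootstrap sample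
is i.i.d. from the empirical measure. On the good event the empirical sums of squares are `O(R²)`
and those of `a k` are `O(K R)`, so the same deviation inequality applies a second time,
conditionally (`exists_good_samples`). All constants are independent of `P`, and only monotonicity
and subadditivity of outer measures are applied to possibly non-measurable events. -/

/-! ### Exponential inequalities for i.i.d. sums -/

/-- Chernoff bound for the sum of an i.i.d. sample of a bounded function. -/
theorem measure_pi_lt_sum_le {Ω : Type*} [MeasurableSpace Ω] (μ : Measure Ω)
    [IsProbabilityMeasure μ] {c : Ω → ℝ} (hc : Measurable c) {B l : ℝ} (hB : ∀ z, |c z| ≤ B)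
    (hl : 0 ≤ l) (hlB : l * B ≤ 1) (n : ℕ) (t : ℝ) :
    (Measure.pi fun _ : Fin n => μ) {w | t < ∑ i, c (w i)} ≤
      ENNReal.ofReal (Real.exp (-(l * t) + n * (l * ∫ z, c z ∂μ + l ^ 2 * ∫ z, c z ^ 2 ∂μ))) := by
  have hlc : ∀ z, |l * c z| ≤ 1 := fun z => by
    rw [abs_mul, abs_of_nonneg hl]
    exact (mul_le_mul_of_nonneg_left (hB z) hl).trans hlB
  have hint : Integrable c μ :=
    Integrable.of_bound hc.aestronglyMeasurable B (ae_of_all _ hB)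
  have hint2 : Integrable (fun z => c z ^ 2) μ :=
    Integrable.of_bound (hc.pow_const 2).aestronglyMeasurable (B ^ 2) (ae_of_all _ fun z => by
      rw [Real.norm_eq_abs, abs_pow]
      exact pow_le_pow_left₀ (abs_nonneg _) (hB z) 2)
  have hexp : ∀ z, Real.exp (l * c z) ≤ 1 + (l * c z + l ^ 2 * c z ^ 2) := fun z => by
    have := (abs_le.1 (Real.abs_exp_sub_one_sub_id_le (hlc z))).2
    linarith [mul_pow l (c z) 2]
  have hmgf1 : ∫ z, Real.exp (l * c z) ∂μ ≤
      Real.exp (l * ∫ z, c z ∂μ + l ^ 2 * ∫ z, c z ^ 2 ∂μ) := by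
    have hi : Integrable (fun z => l * c z + l ^ 2 * c z ^ 2) μ :=
      (hint.const_mul l).add (hint2.const_mul _)
    calc ∫ z, Real.exp (l * c z) ∂μ ≤ ∫ z, (1 + (l * c z + l ^ 2 * c z ^ 2)) ∂μ := by
          refine integral_mono_of_nonneg (ae_of_all _ fun z => (Real.exp_pos _).le)
            ((integrable_const 1).add hi) (ae_of_all _ hexp)
      _ = (l * ∫ z, c z ∂μ + l ^ 2 * ∫ z, c z ^ 2 ∂μ) + 1 := by
          rw [integral_add (integrable_const 1) hi,
            integral_add (hint.const_mul l) (hint2.const_mul _), integral_const_mul,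
            integral_const_mul]
          simp [add_comm]
      _ ≤ _ := Real.add_one_le_exp _
  have hprod : ∀ w : Fin n → Ω, Real.exp (l * ∑ i, c (w i)) = ∏ i, Real.exp (l * c (w i)) := by
    intro w
    rw [Finset.mul_sum, Real.exp_sum]
  have hmeas : Measurable fun w : Fin n → Ω => Real.exp (l * ∑ i, c (w i)) := by fun_prop
  have hi : Integrable (fun w : Fin n → Ω => Real.exp (l * ∑ i, c (w i)))
      (Measure.pi fun _ : Fin n => μ) := by
    refine Integrable.of_bound hmeas.aestronglyMeasurable (Real.exp (n * 1)) (ae_of_all _ ?_)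
    intro w
    rw [Real.norm_eq_abs, Real.abs_exp, Real.exp_le_exp, Finset.mul_sum]
    calc ∑ i, l * c (w i) ≤ ∑ _i : Fin n, (1 : ℝ) :=
          Finset.sum_le_sum fun i _ => (abs_le.1 (hlc (w i))).2
      _ = n * 1 := by simp
  have h1 := measure_ge_le_exp_mul_mgf (X := fun w : Fin n → Ω => ∑ i, c (w i)) t hl hi
  have h2 : mgf (fun w : Fin n → Ω => ∑ i, c (w i)) (Measure.pi fun _ : Fin n => μ) l ≤
      Real.exp (n * (l * ∫ z, c z ∂μ + l ^ 2 * ∫ z, c z ^ 2 ∂μ)) := by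
    rw [mgf]
    simp_rw [hprod]
    rw [integral_fintype_prod_eq_pow (fun z => Real.exp (l * c z)), Fintype.card_fin,
      Real.exp_nat_mul]
    exact pow_le_pow_left₀ (integral_nonneg fun z => (Real.exp_pos _).le) hmgf1 n
  calc (Measure.pi fun _ : Fin n => μ) {w | t < ∑ i, c (w i)}
      ≤ (Measure.pi fun _ : Fin n => μ) {w | t ≤ ∑ i, c (w i)} :=
        measure_mono (Set.ofPred_subset_ofPred.2 fun w hw => hw.le)
    _ = ENNReal.ofReal ((Measure.pi fun _ : Fin n => μ).real {w | t ≤ ∑ i, c (w i)}) := by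
        rw [ofReal_measureReal]
    _ ≤ _ := by
        refine ENNReal.ofReal_le_ofReal (h1.trans ?_)
        rw [Real.exp_add, ← neg_mul]
        exact mul_le_mul_of_nonneg_left h2 (Real.exp_pos _).le

/-- Chernoff bound for the sum of an i.i.d. sample of a nonnegative bounded function. -/
theorem measure_pi_lt_sum_le_of_nonneg {Ω : Type*} [MeasurableSpace Ω] (μ : Measure Ω)
    [IsProbabilityMeasure μ] {c : Ω → ℝ} (hc : Measurable c) {B l : ℝ} (h0 : ∀ z, 0 ≤ c z)
    (hB : ∀ z, c z ≤ B) (hl : 0 ≤ l) (hlB : l * B ≤ 1) (n : ℕ) (t : ℝ) :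
    (Measure.pi fun _ : Fin n => μ) {w | t < ∑ i, c (w i)} ≤
      ENNReal.ofReal (Real.exp (-(l * t) + 2 * (l * (n * ∫ z, c z ∂μ)))) := by
  have hB' : ∀ z, |c z| ≤ B := fun z => by rw [abs_of_nonneg (h0 z)]; exact hB z
  refine (measure_pi_lt_sum_le μ hc hB' hl hlB n t).trans
    (ENNReal.ofReal_le_ofReal (Real.exp_le_exp.2 ?_))
  have hint : Integrable c μ :=
    Integrable.of_bound hc.aestronglyMeasurable B (ae_of_all _ hB')
  -- Since `0 ≤ l * c ≤ 1`, the quadratic term is absorbed by the linear one, whence the factor 2.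
  have : l ^ 2 * ∫ z, c z ^ 2 ∂μ ≤ l * ∫ z, c z ∂μ := by
    rw [← integral_const_mul, ← integral_const_mul]
    refine integral_mono_of_nonneg (ae_of_all _ fun z => by positivity) (hint.const_mul l)
      (ae_of_all _ fun z => ?_)
    have h1 : l * c z ≤ 1 := (mul_le_mul_of_nonneg_left (hB z) hl).trans hlB
    have h2 : 0 ≤ l * c z := mul_nonneg hl (h0 z)
    calc l ^ 2 * c z ^ 2 = (l * c z) * (l * c z) := by ring
      _ ≤ 1 * (l * c z) := mul_le_mul_of_nonneg_right h1 h2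
      _ = l * c z := one_mul _
  nlinarith [mul_le_mul_of_nonneg_left this (Nat.cast_nonneg (α := ℝ) n)]

/-- Simultaneous Chernoff bounds for finitely many bounded functions `f k` and nonnegative
bounded functions `a k`. -/
theorem measure_pi_exists_deviation_le {Ω ι : Type*} [MeasurableSpace Ω] (μ : Measure Ω)
    [IsProbabilityMeasure μ] (t : Finset ι) {f a : ι → Ω → ℝ} (hf : ∀ k ∈ t, Measurable (f k))
    (ha : ∀ k ∈ t, Measurable (a k)) {T V A K R : ℝ} (n : ℕ) (M : ℝ)
    (hT : 0 ≤ T) (hV : 0 ≤ V) (hA : 0 ≤ A) (hK : 0 ≤ K) (hR : 0 < R) (hTR : 2 * T * K ≤ R)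
    (hfT : ∀ k ∈ t, ∀ z, |f k z| ≤ T)
    (ha0 : ∀ k ∈ t, ∀ z, 0 ≤ a k z) (haT : ∀ k ∈ t, ∀ z, a k z ≤ 2 * T)
    (hfV : ∀ k ∈ t, n * ∫ z, f k z ^ 2 ∂μ ≤ V * R ^ 2)
    (haA : ∀ k ∈ t, n * ∫ z, a k z ∂μ ≤ A * (K * R)) :
    (Measure.pi fun _ : Fin n => μ) {w | ∃ k ∈ t,
        M * (K * R) < |∑ i, f k (w i) - n * ∫ z, f k z ∂μ| ∨ M * (K * R) < ∑ i, a k (w i) ∨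
          M * R ^ 2 < ∑ i, f k (w i) ^ 2} ≤
      t.card * ENNReal.ofReal (4 * Real.exp (-((M - 2 * V - 2 * A) * K ^ 2))) := by
  set Q := (Measure.pi fun _ : Fin n => μ) with hQ
  set e := Real.exp (-((M - 2 * V - 2 * A) * K ^ 2)) with he
  -- This Chernoff parameter turns the level `K * R` and a variance of order `R ^ 2` both into
  -- multiples of `K ^ 2`; `2 * T * K ≤ R` makes it admissible.
  set l := K / R with hl
  have hl0 : 0 ≤ l := div_nonneg hK hR.le
  have hlR : l * R = K := div_mul_cancel₀ _ hR.ne'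
  have hlT2 : l * (2 * T) ≤ 1 := by
    rw [hl, div_mul_eq_mul_div, div_le_one hR]; linarith
  have hlT : l * T ≤ 1 := by nlinarith [mul_nonneg hl0 hT]
  have hlTT : l ^ 2 * T ^ 2 ≤ 1 := by nlinarith [mul_nonneg hl0 hT]
  have hVK := mul_nonneg hV (sq_nonneg K)
  have hAK := mul_nonneg hA (sq_nonneg K)
  have key : ∀ k ∈ t, Q {w | M * (K * R) < |∑ i, f k (w i) - n * ∫ z, f k z ∂μ| ∨
      M * (K * R) < ∑ i, a k (w i) ∨ M * R ^ 2 < ∑ i, f k (w i) ^ 2} ≤ ENNReal.ofReal (4 * e) := by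
    intro k hk
    have hexpf : -(l * (M * (K * R))) + n * (l ^ 2 * ∫ z, f k z ^ 2 ∂μ) ≤
        -((M - 2 * V - 2 * A) * K ^ 2) := by
      have h1 : l * (M * (K * R)) = M * K ^ 2 := by
        rw [← hlR]; ring
      have h2 : n * (l ^ 2 * ∫ z, f k z ^ 2 ∂μ) ≤ V * K ^ 2 := by
        calc n * (l ^ 2 * ∫ z, f k z ^ 2 ∂μ) = l ^ 2 * (n * ∫ z, f k z ^ 2 ∂μ) := by ring
          _ ≤ l ^ 2 * (V * R ^ 2) := mul_le_mul_of_nonneg_left (hfV k hk) (sq_nonneg _)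
          _ = V * K ^ 2 := by rw [← hlR]; ring
      linarith
    have b1 : Q {w | M * (K * R) + n * ∫ z, f k z ∂μ < ∑ i, f k (w i)} ≤ ENNReal.ofReal e := by
      refine (measure_pi_lt_sum_le μ (hf k hk) (hfT k hk) hl0 hlT n _).trans
        (ENNReal.ofReal_le_ofReal (Real.exp_le_exp.2 ?_))
      linarith
    have b2 : Q {w | M * (K * R) - n * ∫ z, f k z ∂μ < ∑ i, -f k (w i)} ≤ ENNReal.ofReal e := by
      refine (measure_pi_lt_sum_le μ (hf k hk).neg (B := T) (fun z => ?_) hl0 hlT n _).trans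
        (ENNReal.ofReal_le_ofReal (Real.exp_le_exp.2 ?_))
      · simpa using hfT k hk z
      · simp only [Pi.neg_apply, integral_neg, neg_sq]
        linarith
    have b3 : Q {w | M * (K * R) < ∑ i, a k (w i)} ≤ ENNReal.ofReal e := by
      refine (measure_pi_lt_sum_le_of_nonneg μ (ha k hk) (ha0 k hk) (haT k hk) hl0 hlT2 n _).trans
        (ENNReal.ofReal_le_ofReal (Real.exp_le_exp.2 ?_))
      have h1 : l * (M * (K * R)) = M * K ^ 2 := by
        rw [← hlR]; ring
      have h2 : l * (n * ∫ z, a k z ∂μ) ≤ A * K ^ 2 := by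
        calc l * (n * ∫ z, a k z ∂μ) ≤ l * (A * (K * R)) :=
              mul_le_mul_of_nonneg_left (haA k hk) hl0
          _ = A * K ^ 2 := by rw [← hlR]; ring
      linarith
    -- The squares are bounded by `T ^ 2` and have level `R ^ 2`, so the parameter is `l ^ 2`; the
    -- exponent is again of order `K ^ 2`.
    have b4 : Q {w | M * R ^ 2 < ∑ i, f k (w i) ^ 2} ≤ ENNReal.ofReal e := by
      refine (measure_pi_lt_sum_le_of_nonneg μ ((hf k hk).pow_const 2) (fun z => sq_nonneg _)
        (B := T ^ 2) (fun z => ?_) (sq_nonneg l) hlTT n _).trans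
        (ENNReal.ofReal_le_ofReal (Real.exp_le_exp.2 ?_))
      · rw [← sq_abs]
        exact pow_le_pow_left₀ (abs_nonneg _) (hfT k hk z) 2
      · have h1 : l ^ 2 * (M * R ^ 2) = M * K ^ 2 := by
          rw [← hlR]; ring
        have h2 : l ^ 2 * (n * ∫ z, f k z ^ 2 ∂μ) ≤ V * K ^ 2 := by
          calc l ^ 2 * (n * ∫ z, f k z ^ 2 ∂μ) ≤ l ^ 2 * (V * R ^ 2) :=
                mul_le_mul_of_nonneg_left (hfV k hk) (sq_nonneg _)
            _ = V * K ^ 2 := by rw [← hlR]; ring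
        linarith
    have hsub : {w : Fin n → Ω | M * (K * R) < |∑ i, f k (w i) - n * ∫ z, f k z ∂μ| ∨
        M * (K * R) < ∑ i, a k (w i) ∨ M * R ^ 2 < ∑ i, f k (w i) ^ 2} ⊆
        (({w | M * (K * R) + n * ∫ z, f k z ∂μ < ∑ i, f k (w i)} ∪
          {w | M * (K * R) - n * ∫ z, f k z ∂μ < ∑ i, -f k (w i)}) ∪
          {w | M * (K * R) < ∑ i, a k (w i)}) ∪ {w | M * R ^ 2 < ∑ i, f k (w i) ^ 2} := by
      rintro w (hw | hw | hw)
      · refine Or.inl (Or.inl ?_)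
        rcases lt_abs.1 hw with hw | hw
        · exact Or.inl (by simp only [Set.mem_ofPred_eq]; linarith)
        · refine Or.inr ?_
          rw [Set.mem_ofPred_eq, Finset.sum_neg_distrib]
          linarith
      · exact Or.inl (Or.inr hw)
      · exact Or.inr hw
    have he0 : 0 ≤ e := (Real.exp_pos _).le
    calc _ ≤ _ := measure_mono hsub
      _ ≤ ENNReal.ofReal e + ENNReal.ofReal e + ENNReal.ofReal e + ENNReal.ofReal e :=
        (measure_union_le _ _).trans (add_le_add ((measure_union_le _ _).trans
          (add_le_add ((measure_union_le _ _).trans (add_le_add b1 b2)) b3)) b4)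
      _ = ENNReal.ofReal (4 * e) := by
        rw [← ENNReal.ofReal_add he0 he0, ← ENNReal.ofReal_add (by positivity) he0,
          ← ENNReal.ofReal_add (by positivity) he0]
        congr 1; ring
  calc _ ≤ Q (⋃ k ∈ t, {w | M * (K * R) < |∑ i, f k (w i) - n * ∫ z, f k z ∂μ| ∨
      M * (K * R) < ∑ i, a k (w i) ∨ M * R ^ 2 < ∑ i, f k (w i) ^ 2}) := by
        refine measure_mono ?_
        rintro w ⟨k, hk, hw⟩
        exact Set.mem_biUnion (x := k) hk hw
    _ ≤ ∑ k ∈ t, Q {w | M * (K * R) < |∑ i, f k (w i) - n * ∫ z, f k z ∂μ| ∨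
      M * (K * R) < ∑ i, a k (w i) ∨ M * R ^ 2 < ∑ i, f k (w i) ^ 2} :=
        measure_biUnion_finset_le _ _
    _ ≤ ∑ _k ∈ t, ENNReal.ofReal (4 * e) := Finset.sum_le_sum key
    _ = _ := by rw [Finset.sum_const, nsmul_eq_mul]

/-! ### Moments, outer expectations and truncation -/

theorem integrable_and_integral_le_of_lintegral_le {Ω : Type*} [MeasurableSpace Ω] {μ : Measure Ω}
    {u : Ω → ℝ} (hu : Measurable u) (h0 : ∀ z, 0 ≤ u z) {c : ℝ} (hc : 0 ≤ c)
    (h : ∫⁻ z, ENNReal.ofReal (u z) ∂μ ≤ ENNReal.ofReal c) :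
    Integrable u μ ∧ ∫ z, u z ∂μ ≤ c := by
  refine ⟨⟨hu.aestronglyMeasurable, ?_⟩, ?_⟩
  · rw [hasFiniteIntegral_iff_ofReal (ae_of_all _ h0)]
    exact h.trans_lt ENNReal.ofReal_lt_top
  · rw [integral_eq_lintegral_of_nonneg_ae (ae_of_all _ h0) hu.aestronglyMeasurable]
    exact ENNReal.toReal_le_of_le_ofReal hc h

/-- The first absolute moment is at most the root of the second moment. -/
theorem integrable_and_integral_abs_le_sqrt {Ω : Type*} [MeasurableSpace Ω] {μ : Measure Ω}
    [IsProbabilityMeasure μ] {u : Ω → ℝ} (hu : Measurable u) {e : ℝ} (he : 0 < e)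
    (h : ∫⁻ z, ENNReal.ofReal (u z ^ 2) ∂μ ≤ ENNReal.ofReal e) :
    Integrable u μ ∧ ∫ z, |u z| ∂μ ≤ √e := by
  obtain ⟨hi, hle⟩ := integrable_and_integral_le_of_lintegral_le (hu.pow_const 2)
    (fun z => sq_nonneg (u z)) he.le h
  have hs : 0 < √e := Real.sqrt_pos.2 he
  have hse : √e * √e = e := Real.mul_self_sqrt he.le
  -- Arithmetic-geometric mean inequality, with the weight that is optimal when the second moment is
  -- `e`.
  have hpt : ∀ z, |u z| ≤ (2 * √e)⁻¹ * u z ^ 2 + √e / 2 := by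
    intro z
    rw [← sq_abs, inv_mul_eq_div, div_add_div _ _ (by positivity) two_ne_zero,
      le_div_iff₀ (by positivity)]
    nlinarith [sq_nonneg (|u z| - √e)]
  have hi2 : Integrable (fun z => (2 * √e)⁻¹ * u z ^ 2 + √e / 2) μ :=
    (hi.const_mul _).add (integrable_const _)
  refine ⟨hi2.mono' hu.aestronglyMeasurable (ae_of_all _ hpt), ?_⟩
  calc ∫ z, |u z| ∂μ ≤ ∫ z, ((2 * √e)⁻¹ * u z ^ 2 + √e / 2) ∂μ :=
        integral_mono_of_nonneg (ae_of_all _ fun z => abs_nonneg _) hi2 (ae_of_all _ hpt)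
    _ = (2 * √e)⁻¹ * ∫ z, u z ^ 2 ∂μ + √e / 2 := by
        rw [integral_add (hi.const_mul _) (integrable_const _), integral_const_mul]
        simp
    _ ≤ (2 * √e)⁻¹ * e + √e / 2 := by gcongr
    _ = √e := by
        rw [inv_mul_eq_div]
        nth_rewrite 1 [← hse]
        field_simp
        ring

/-- The infimum defining an outer expectation need not be assumed attained, hence the strict
hypothesis; later constants carry some slack to provide it. -/
theorem exists_measurable_majorant {α : Type*} [MeasurableSpace α] {μ : Measure α}
    {Z : α → ℝ≥0∞} {c : ℝ≥0∞} (h : outerExp μ Z < c) :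
    ∃ g : α → ℝ≥0∞, Measurable g ∧ Z ≤ g ∧ ∫⁻ a, g a ∂μ ≤ c := by
  simp only [outerExp, iInf_lt_iff] at h
  obtain ⟨g, hg, hZ, hlt⟩ := h
  exact ⟨g, hg, hZ, hlt.le⟩

/-- Truncation of a real number to `[-T, T]`. -/
noncomputable def clip (T x : ℝ) : ℝ := max (-T) (min T x)

theorem measurable_clip (T : ℝ) : Measurable (clip T) := by
  unfold clip; fun_prop

theorem clip_eq_self {T x : ℝ} (h : |x| ≤ T) : clip T x = x := by
  rw [clip, min_eq_right (abs_le.1 h).2, max_eq_right (abs_le.1 h).1]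

theorem abs_clip_le {T : ℝ} (hT : 0 ≤ T) (x : ℝ) : |clip T x| ≤ T :=
  abs_le.2 ⟨le_max_left _ _, max_le (by linarith) (min_le_left _ _)⟩

theorem abs_clip_le_abs {T : ℝ} (hT : 0 ≤ T) (x : ℝ) : |clip T x| ≤ |x| := by
  rcases le_total |x| T with h | h
  · rw [clip_eq_self h]
  · exact (abs_clip_le hT x).trans h

/-- The excess vanishes for `|x| ≤ T`, and otherwise `|x| ≤ |x| * (|x| / T) ^ 3`. So truncation
biases a mean by at most the fourth moment over `T ^ 3`. -/
theorem abs_sub_clip_le {T : ℝ} (hT : 0 < T) (x : ℝ) : |x - clip T x| ≤ x ^ 4 / T ^ 3 := by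
  rcases le_total |x| T with h | h
  · rw [clip_eq_self h, sub_self, abs_zero]; positivity
  · have h1 : |x - clip T x| ≤ |x| := by
      rcases le_total 0 x with hx | hx
      · rw [abs_of_nonneg hx] at h ⊢
        rw [clip, min_eq_left h, max_eq_right (by linarith), abs_of_nonneg (by linarith)]
        linarith
      · rw [abs_of_nonpos hx] at h ⊢
        rw [clip, min_eq_right (by linarith), max_eq_left (by linarith),
          abs_of_nonpos (by linarith)]
        linarith
    refine h1.trans ?_
    rw [le_div_iff₀ (by positivity)]
    calc |x| * T ^ 3 ≤ |x| * |x| ^ 3 := by gcongr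
      _ = x ^ 4 := by rw [← pow_succ', ← abs_pow, abs_of_nonneg (Even.pow_nonneg (by decide) x)]

/-- Truncation and discretization of a class of functions `f · s` with a fourth moment envelope:
on `E` the functions are bounded by `T`, and the increments around the grid point `k` are bounded
by `a k`. -/
theorem exists_truncation_grid {Ω σ : Type*} [MeasurableSpace Ω] (μ : Measure Ω)
    [IsProbabilityMeasure μ] {S : Set σ} {f : Ω → σ → ℝ}
    (hf : ∀ s ∈ S, Measurable fun z => f z s) {t : Finset σ} (ht : ↑t ⊆ S) {N : σ → Set σ}
    (hN : ∀ k ∈ t, N k ⊆ S) {c e T : ℝ} (hc : 0 < c) (he : 0 < e) (hT : 0 < T)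
    (hG : outerExp μ (fun z => ⨆ s ∈ S, ENNReal.ofReal (f z s ^ 4)) < ENNReal.ofReal c)
    (hg : ∀ k ∈ t, outerExp μ (fun z => ⨆ s ∈ N k, ENNReal.ofReal ((f z k - f z s) ^ 2)) <
      ENNReal.ofReal e) :
    ∃ (E : Set Ω) (a : σ → Ω → ℝ), μ Eᶜ ≤ ENNReal.ofReal (c / T ^ 4) ∧
      (∀ z ∈ E, ∀ s ∈ S, |f z s| ≤ T) ∧ (∀ k ∈ t, Measurable (a k)) ∧
      (∀ k ∈ t, ∀ z, 0 ≤ a k z) ∧ (∀ k ∈ t, ∀ z, a k z ≤ 2 * T) ∧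
      (∀ k ∈ t, ∫ z, a k z ∂μ ≤ √e) ∧
      (∀ k ∈ t, ∀ s ∈ N k, ∀ z ∈ E, |f z s - f z k| ≤ a k z) ∧
      (∀ k ∈ t, ∀ s ∈ N k, |∫ z, f z s ∂μ - ∫ z, clip T (f z k) ∂μ| ≤ √e + c / T ^ 3) := by
  obtain ⟨G, hGm, hGZ, hGc⟩ := exists_measurable_majorant hG
  have hex : ∀ k, ∃ g : Ω → ℝ≥0∞, k ∈ t → Measurable g ∧
      (fun z => ⨆ s ∈ N k, ENNReal.ofReal ((f z k - f z s) ^ 2)) ≤ g ∧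
      ∫⁻ z, g z ∂μ ≤ ENNReal.ofReal e := by
    intro k
    by_cases hk : k ∈ t
    · obtain ⟨g, hg⟩ := exists_measurable_majorant (hg k hk)
      exact ⟨g, fun _ => hg⟩
    · exact ⟨0, fun h => absurd h hk⟩
  choose g hgall using hex
  have hfG : ∀ z, ∀ s ∈ S, ENNReal.ofReal (f z s ^ 4) ≤ G z := fun z s hs =>
    (le_iSup₂ (f := fun s (_ : s ∈ S) => ENNReal.ofReal (f z s ^ 4)) s hs).trans (hGZ z)
  have hfg : ∀ k ∈ t, ∀ s ∈ N k, ∀ z, ENNReal.ofReal ((f z k - f z s) ^ 2) ≤ g k z :=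
    fun k hk s hs z =>
      (le_iSup₂ (f := fun s (_ : s ∈ N k) => ENNReal.ofReal ((f z k - f z s) ^ 2)) s hs).trans
        ((hgall k hk).2.1 z)
  -- The cap makes `a k = √b` bounded by `2 * T`. It costs nothing on `E`, where two values bounded
  -- by `T` differ by at most `2 * T`.
  let b : σ → Ω → ℝ≥0∞ := fun k z => min (g k z) (ENNReal.ofReal ((2 * T) ^ 2))
  have hbtop : ∀ k z, b k z ≠ ∞ := fun k z =>
    ((min_le_right _ _).trans_lt ENNReal.ofReal_lt_top).ne
  have hET : ∀ z ∈ {z | G z ≤ ENNReal.ofReal (T ^ 4)}, ∀ s ∈ S, |f z s| ≤ T := by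
    intro z hz s hs
    have h1 := (ENNReal.ofReal_le_ofReal_iff (by positivity)).1 ((hfG z s hs).trans hz)
    refine le_of_pow_le_pow_left₀ four_ne_zero hT.le ?_
    rwa [← abs_pow, abs_of_nonneg (by positivity)]
  have ham : ∀ k ∈ t, Measurable fun z => √((b k z).toReal) := fun k hk =>
    (((hgall k hk).1.min measurable_const).ennreal_toReal).sqrt
  refine ⟨{z | G z ≤ ENNReal.ofReal (T ^ 4)}, fun k z => √((b k z).toReal), ?_, hET, ham,
    fun k _ z => Real.sqrt_nonneg _, ?_, ?_, ?_, ?_⟩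
  · have h1 : ENNReal.ofReal (T ^ 4) * μ {z | ENNReal.ofReal (T ^ 4) ≤ G z} ≤ ENNReal.ofReal c :=
      (mul_meas_ge_le_lintegral₀ hGm.aemeasurable _).trans hGc
    rw [ENNReal.ofReal_div_of_pos (by positivity)]
    rw [ENNReal.le_div_iff_mul_le (Or.inl (by simp [hT])) (Or.inl ENNReal.ofReal_ne_top), mul_comm]
    refine le_trans ?_ h1
    gcongr
    intro z hz
    rw [Set.mem_compl_iff, Set.mem_ofPred_eq, not_le] at hz
    exact hz.le
  · intro k _ z
    refine Real.sqrt_le_iff.2 ⟨by positivity, ?_⟩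
    exact ENNReal.toReal_le_of_le_ofReal (by positivity) (min_le_right _ _)
  · intro k hk
    have := (integrable_and_integral_abs_le_sqrt (μ := μ) (ham k hk) he ?_).2
    · simpa only [abs_of_nonneg (Real.sqrt_nonneg _)] using this
    · simp only [Real.sq_sqrt ENNReal.toReal_nonneg]
      refine le_trans (lintegral_mono fun z => ?_) (hgall k hk).2.2
      rw [ENNReal.ofReal_toReal (hbtop k z)]
      exact min_le_left _ _
  · intro k hk s hs z hz
    refine Real.le_sqrt_of_sq_le ?_
    refine (ENNReal.ofReal_le_iff_le_toReal (hbtop k z)).1 (le_min ?_ ?_)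
    · rw [sq_abs, ← neg_sq, neg_sub]
      exact hfg k hk s hs z
    · refine ENNReal.ofReal_le_ofReal (pow_le_pow_left₀ (abs_nonneg _) ?_ 2)
      have h1 := hET z hz s (hN k hk hs)
      have h2 := hET z hz k (ht hk)
      calc |f z s - f z k| ≤ |f z s| + |f z k| := abs_sub _ _
        _ ≤ 2 * T := by linarith
  -- The bias has two parts: replacing `s` by `k` costs `√e`, truncating at `k` costs `c / T ^ 3`.
  · intro k hk s hs
    have mk := hf k (ht hk)
    have ms := hf s (hN k hk hs)
    obtain ⟨i1, l1⟩ := integrable_and_integral_abs_le_sqrt (μ := μ) (mk.sub ms) he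
      ((lintegral_mono fun z => hfg k hk s hs z).trans (hgall k hk).2.2)
    obtain ⟨i4, l4⟩ := integrable_and_integral_le_of_lintegral_le (μ := μ) (mk.pow_const 4)
      (fun z => by positivity) hc.le ((lintegral_mono fun z => hfG z k (ht hk)).trans hGc)
    have hclip : Integrable (fun z => clip T (f z k)) μ :=
      Integrable.of_bound ((measurable_clip T).comp mk).aestronglyMeasurable T
        (ae_of_all _ fun z => abs_clip_le hT.le _)
    have i5 : Integrable (fun z => f z k ^ 4 / T ^ 3) μ := i4.div_const _
    have i6 : Integrable (fun z => f z k - clip T (f z k)) μ :=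
      i5.mono' (mk.sub ((measurable_clip T).comp mk)).aestronglyMeasurable
        (ae_of_all _ fun z => abs_sub_clip_le hT _)
    have l6 : |∫ z, (f z k - clip T (f z k)) ∂μ| ≤ c / T ^ 3 := by
      refine (abs_integral_le_integral_abs).trans ?_
      refine (integral_mono_of_nonneg (ae_of_all _ fun z => abs_nonneg _) i5
        (ae_of_all _ fun z => abs_sub_clip_le hT _)).trans ?_
      rw [integral_div]
      gcongr
    have ik : Integrable (fun z => f z k) μ := by
      refine (i6.add hclip).congr (ae_of_all _ fun z => ?_)
      simp
    have is : Integrable (fun z => f z s) μ := by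
      refine (ik.sub i1).congr (ae_of_all _ fun z => ?_)
      simp
    have l7 : |∫ z, (f z k - f z s) ∂μ| ≤ √e := abs_integral_le_integral_abs.trans l1
    rw [integral_sub ik hclip] at l6
    rw [integral_sub ik is] at l7
    rw [abs_le] at *
    constructor <;> linarith [l6.1, l6.2, l7.1, l7.2]

/-! ### The empirical process and its bootstrap -/

theorem card_mul_integral_uniformOn_univ {n : ℕ} (hn : 1 ≤ n) (u : Fin n → ℝ) :
    n * ∫ i, u i ∂(uniformOn (Set.univ : Set (Fin n))) = ∑ i, u i := by
  have : NeZero n := ⟨by omega⟩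
  have := isProbabilityMeasure_uniformOn (Set.finite_univ (α := Fin n)) Set.univ_nonempty
  rw [integral_fintype (Integrable.of_finite)]
  have h : ∀ i : Fin n, (uniformOn (Set.univ : Set (Fin n))).real {i} = (n : ℝ)⁻¹ := by
    intro i
    rw [measureReal_def, uniformOn_univ]
    simp
  have hn' : (n : ℝ) ≠ 0 := by positivity
  simp_rw [h, smul_eq_mul, ← Finset.mul_sum]
  rw [mul_inv_cancel_left₀ hn']

/-- Drawing with replacement is i.i.d. sampling from the uniform law on indices, so the
product-measure inequalities cover the bootstrap. -/
theorem bootLaw_eq_pi (n : ℕ) :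
    bootLaw n = Measure.pi fun _ : Fin n => uniformOn (Set.univ : Set (Fin n)) := by
  rw [bootLaw, ← uniformOn_pi, Set.pi_univ]

/-- Uniform deviation bounds for the empirical process over `S` and for its bootstrap analogue. -/
theorem exists_good_samples {Ω σ : Type*} [MeasurableSpace Ω] (μ : Measure Ω)
    [IsProbabilityMeasure μ] {S : Set σ} {f : Ω → σ → ℝ}
    (hf : ∀ s ∈ S, Measurable fun z => f z s) {t : Finset σ} (ht : ↑t ⊆ S) {N : σ → Set σ}
    (hN : ∀ k ∈ t, N k ⊆ S) (hcover : ∀ s ∈ S, ∃ k ∈ t, s ∈ N k)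
    {c e T V K R M : ℝ} {n : ℕ} (hn : 1 ≤ n) (hc : 0 < c) (he : 0 < e) (hT : 0 < T) (hV : 0 ≤ V)
    (hK : 0 ≤ K) (hR : 0 < R) (hM : 0 ≤ M)
    (hG : outerExp μ (fun z => ⨆ s ∈ S, ENNReal.ofReal (f z s ^ 4)) < ENNReal.ofReal c)
    (hg : ∀ k ∈ t, outerExp μ (fun z => ⨆ s ∈ N k, ENNReal.ofReal ((f z k - f z s) ^ 2)) <
      ENNReal.ofReal e)
    (hfV : ∀ k ∈ t, n * ∫ z, f z k ^ 2 ∂μ ≤ V * R ^ 2)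
    (hfi : ∀ k ∈ t, Integrable (fun z => f z k ^ 2) μ)
    (hTR : 2 * T * K ≤ R) (heT : n * (√e + c / T ^ 3) ≤ K * R) :
    ∃ W : Set (Fin n → Ω),
      (Measure.pi fun _ : Fin n => μ) Wᶜ ≤
        t.card * ENNReal.ofReal (4 * Real.exp (-((M - 2 * V - 2) * K ^ 2))) +
          n * ENNReal.ofReal (c / T ^ 4) ∧
      ∀ w ∈ W, (∀ s ∈ S, |∑ i, f (w i) s - n * ∫ z, f z s ∂μ| ≤ (2 * M + 1) * (K * R)) ∧
        bootLaw n {κ | ∃ s ∈ S, 11 * M * (K * R) < |∑ i, f (w (κ i)) s - ∑ i, f (w i) s|} ≤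
          t.card * ENNReal.ofReal (4 * Real.exp (-(M * K ^ 2))) := by
  obtain ⟨E, a, hE, hET, ham, ha0, haT, hae, haN, hbias⟩ :=
    exists_truncation_grid μ hf ht hN hc he hT hG hg
  have hKR : 0 ≤ K * R := mul_nonneg hK hR.le
  have hn0 : (0 : ℝ) ≤ n := Nat.cast_nonneg n
  have hcT : 0 ≤ c / T ^ 3 := by positivity
  let F : σ → Ω → ℝ := fun k z => clip T (f z k)
  have hFm : ∀ k ∈ t, Measurable (F k) := fun k hk => (measurable_clip T).comp (hf k (ht hk))
  have hdev := measure_pi_exists_deviation_le μ t hFm ham n M hT.le hV zero_le_one hK hR hTR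
    (fun k _ z => abs_clip_le hT.le _) ha0 haT
    (fun k hk => by
      refine le_trans (mul_le_mul_of_nonneg_left ?_ hn0) (hfV k hk)
      refine integral_mono_of_nonneg (ae_of_all _ fun z => sq_nonneg _) (hfi k hk)
        (ae_of_all _ fun z => ?_)
      exact sq_le_sq.2 (abs_clip_le_abs hT.le _))
    (fun k hk => by
      rw [one_mul]
      refine le_trans (mul_le_mul_of_nonneg_left ?_ hn0) heT
      linarith [hae k hk])
  set bad := {w : Fin n → Ω | ∃ k ∈ t,
        M * (K * R) < |∑ i, F k (w i) - n * ∫ z, F k z ∂μ| ∨ M * (K * R) < ∑ i, a k (w i) ∨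
          M * R ^ 2 < ∑ i, F k (w i) ^ 2} with hbad
  refine ⟨{w | ∀ i, w i ∈ E} ∩ badᶜ, ?_, ?_⟩
  · rw [Set.compl_inter, compl_compl, Set.union_comm]
    refine (measure_union_le _ _).trans (add_le_add (by simpa using hdev) ?_)
    calc (Measure.pi fun _ : Fin n => μ) {w | ∀ i, w i ∈ E}ᶜ
        ≤ (Measure.pi fun _ : Fin n => μ) (⋃ i : Fin n, Function.eval i ⁻¹' Eᶜ) := by
          refine measure_mono fun w hw => ?_
          simpa using hw
      _ ≤ ∑ i : Fin n, (Measure.pi fun _ : Fin n => μ) (Function.eval i ⁻¹' Eᶜ) :=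
          measure_iUnion_fintype_le _ _
      _ ≤ ∑ _i : Fin n, ENNReal.ofReal (c / T ^ 4) := by
          refine Finset.sum_le_sum fun i _ => ?_
          refine le_trans ?_ hE
          -- `E` is not known to be measurable here, so its complement is replaced by a measurable
          -- hull of equal measure.
          calc _ ≤ (Measure.pi fun _ : Fin n => μ) (Function.eval i ⁻¹' toMeasurable μ Eᶜ) :=
                measure_mono (Set.preimage_mono (subset_toMeasurable _ _))
            _ = μ (toMeasurable μ Eᶜ) :=
                (measurePreserving_eval (fun _ : Fin n => μ) i).measure_preimage
                  (measurableSet_toMeasurable _ _).nullMeasurableSet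
            _ = μ Eᶜ := measure_toMeasurable _
      _ = _ := by simp
  · rintro w ⟨hwE, hwbad⟩
    have hgood : ∀ k ∈ t, |∑ i, f (w i) k - n * ∫ z, F k z ∂μ| ≤ M * (K * R) ∧
        ∑ i, a k (w i) ≤ M * (K * R) ∧ ∑ i, f (w i) k ^ 2 ≤ M * R ^ 2 := by
      intro k hk
      have hFf : ∀ i, F k (w i) = f (w i) k := fun i => clip_eq_self (hET _ (hwE i) k (ht hk))
      have hnot : ¬ _ := fun h => hwbad ⟨k, hk, h⟩
      simp only [not_or, not_lt, hFf] at hnot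
      exact hnot
    have hinc : ∀ k ∈ t, ∀ s ∈ N k, ∀ κ : Fin n → Fin n,
        |∑ i, f (w (κ i)) s - ∑ i, f (w (κ i)) k| ≤ ∑ i, a k (w (κ i)) := by
      intro k hk s hs κ
      rw [← Finset.sum_sub_distrib]
      exact (Finset.abs_sum_le_sum_abs _ _).trans
        (Finset.sum_le_sum fun i _ => haN k hk s hs _ (hwE _))
    constructor
    · intro s hs
      obtain ⟨k, hk, hsk⟩ := hcover s hs
      obtain ⟨g1, g2, -⟩ := hgood k hk
      have h1 := hinc k hk s hsk id
      simp only [id] at h1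
      have h2 : |n * ∫ z, f z s ∂μ - n * ∫ z, F k z ∂μ| ≤ K * R := by
        rw [← mul_sub, abs_mul, abs_of_nonneg hn0]
        exact (mul_le_mul_of_nonneg_left (hbias k hk s hsk) hn0).trans heT
      -- Increment `M`, deviation at the net point `M` and bias `1` add up to `2 * M + 1`.
      rw [abs_le] at *
      constructor <;> linarith [g1.1, g1.2, h1.1, h1.2, h2.1, h2.2]
    · have : NeZero n := ⟨by omega⟩
      have := isProbabilityMeasure_uniformOn (Set.finite_univ (α := Fin n)) Set.univ_nonempty
      -- The sample bounds on squares and increments serve as moment bounds with `V = A = M` under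
      -- the empirical measure; level `5 * M` leaves the exponent `5 * M - 2 * M - 2 * M = M`.
      have hboot := measure_pi_exists_deviation_le (uniformOn (Set.univ : Set (Fin n))) t
        (f := fun k i => f (w i) k) (a := fun k i => a k (w i))
        (fun k _ => measurable_of_finite _) (fun k _ => measurable_of_finite _) n (5 * M)
        hT.le hM hM hK hR hTR (fun k hk i => hET _ (hwE i) k (ht hk)) (fun k hk i => ha0 k hk _)
        (fun k hk i => haT k hk _)
        (fun k hk => by rw [card_mul_integral_uniformOn_univ hn]; exact (hgood k hk).2.2)
        (fun k hk => by rw [card_mul_integral_uniformOn_univ hn]; exact (hgood k hk).2.1)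
      rw [bootLaw_eq_pi]
      have h5 : 5 * M - 2 * M - 2 * M = M := by ring
      rw [h5] at hboot
      refine le_trans (measure_mono ?_) hboot
      rintro κ ⟨s, hs, hlt⟩
      obtain ⟨k, hk, hsk⟩ := hcover s hs
      refine ⟨k, hk, ?_⟩
      by_contra hcon
      simp only [not_or, not_lt, card_mul_integral_uniformOn_univ hn] at hcon
      obtain ⟨c1, c2, -⟩ := hcon
      have g2 := (hgood k hk).2.1
      have h1 := hinc k hk s hsk κ
      have h2 := hinc k hk s hsk id
      simp only [id] at h2
      refine absurd hlt (not_lt.2 ?_)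
      -- Bootstrap increment `5 * M`, bootstrap deviation `5 * M` and sample increment `M` add up to
      -- `11 * M`.
      rw [abs_le] at *
      constructor <;> linarith [c1.1, c1.2, h1.1, h1.2, h2.1, h2.2]

/-! ### Second moments by localization -/

theorem measurable_bFun {J L d q : ℕ} {β : BetaFun J L d q}
    (hβ : ∀ P n x τ j, Measurable fun yu : Euc L × Euc d => β P n x τ j yu.1 yu.2)
    (h : ℕ → ℝ) (P : ProbabilityMeasure (Obs J L d)) (n : ℕ) (j : Fin J) (x : Euc d) (τ : Euc q) :
    Measurable fun z => bFun β h P n j z x τ := by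
  have : Measurable fun z : Obs J L d => ((z.1 j, (h n)⁻¹ • (z.2 - x)) : Euc L × Euc d) := by
    fun_prop
  exact (hβ P n x τ j).comp this

/-- The second moment of `b_{n,j}(x, τ)` is of the order `hᵈ`. -/
theorem lintegral_bFun_sq_le {J L d q : ℕ} {𝓜 : Set (ProbabilityMeasure (Obs J L d))}
    {S : Set (Euc d × Euc q)} {β : BetaFun J L d q}
    (hβ : ∀ P n x τ j, Measurable fun yu : Euc L × Euc d => β P n x τ j yu.1 yu.2)
    {K₀ : Set (Euc d)} (hK₀ : MeasurableSet K₀) (hA2 : KernelType 𝓜 S β K₀) {C₀ ε₀ : ℝ}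
    (hmom : CondMoment 𝓜 S β K₀ C₀ ε₀) {P : ProbabilityMeasure (Obs J L d)} (hP : P ∈ 𝓜)
    (hX : ((P : Measure (Obs J L d)).map fun z => z.2) ≪ volume) {h : ℕ → ℝ} {n : ℕ} (hn : 1 ≤ n)
    (hh : 0 < h n) (hsmall : ∀ u ∈ K₀, ∀ l, |h n * u l| ≤ ε₀) (j : Fin J) {x : Euc d} {τ : Euc q}
    (hxτ : (x, τ) ∈ S) :
    ∫⁻ z, ENNReal.ofReal (bFun β h P n j z x τ ^ 2) ∂(P : Measure (Obs J L d)) ≤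
      ENNReal.ofReal C₀ * (ENNReal.ofReal (h n ^ d) * volume K₀) := by
  set μ := (P : Measure (Obs J L d)) with hμ
  let U : Euc d → Euc d := fun x' => (h n)⁻¹ • (x' - x)
  have hU : Measurable U := by fun_prop
  let φ : Euc d × Euc L → ℝ≥0∞ := fun p =>
    (U ⁻¹' K₀).indicator 1 p.1 * ENNReal.ofReal (β P n x τ j p.2 (U p.1) ^ 2)
  have hφ : Measurable φ := by
    refine Measurable.mul ?_ ?_
    · exact (measurable_one.indicator (hU hK₀)).comp measurable_fst
    · have h1 : Measurable fun p : Euc d × Euc L => ((p.2, U p.1) : Euc L × Euc d) := by fun_prop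
      exact (((hβ P n x τ j).comp h1).pow_const 2).ennreal_ofReal
  have hY : Measurable fun z : Obs J L d => z.1 j := by fun_prop
  -- The kernel condition only concerns `y` in the support of `Y_j`, which carries full mass.
  have hsupp : ∀ᵐ z ∂μ, z.1 j ∈ (μ.map fun z => z.1 j).support :=
    ae_of_ae_map hY.aemeasurable Measure.support_mem_ae
  have hvol : volume (U ⁻¹' K₀) = ENNReal.ofReal (h n ^ d) * volume K₀ := by
    have hpre : U ⁻¹' K₀ = AffineMap.homothety x (h n) '' ((fun y => y + x) '' K₀) := by
      ext y
      constructor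
      · intro hy
        refine ⟨U y + x, ⟨U y, hy, rfl⟩, ?_⟩
        simp [U, AffineMap.homothety_apply, smul_smul, hh.ne']
      · rintro ⟨_, ⟨u, hu, rfl⟩, rfl⟩
        simpa [U, AffineMap.homothety_apply, smul_smul, hh.ne'] using hu
    rw [hpre, Measure.addHaar_image_homothety, finrank_euclideanSpace_fin,
      abs_of_pos (pow_pos hh d), Set.image_add_right, measure_preimage_add_right]
  calc ∫⁻ z, ENNReal.ofReal (bFun β h P n j z x τ ^ 2) ∂μ
      ≤ ∫⁻ z, φ (z.2, z.1 j) ∂μ := by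
        refine lintegral_mono_ae ?_
        filter_upwards [hsupp] with z hz
        by_cases hu : U z.2 ∈ K₀
        · simp only [φ, Set.indicator_of_mem (show z.2 ∈ U ⁻¹' K₀ from hu), Pi.one_apply, one_mul]
          exact le_rfl
        · have : bFun β h P n j z x τ = 0 := hA2 P hP n hn x τ hxτ j _ hz _ hu
          simp [this]
    _ = ∫⁻ p, φ p ∂(μ.map fun z => (z.2, z.1 j)) := by
        rw [lintegral_map hφ (by fun_prop)]
    _ = ∫⁻ p, φ p ∂((μ.map fun z => z.2) ⊗ₘ condDistrib (fun z => z.1 j) (fun z => z.2) μ) := by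
        rw [compProd_map_condDistrib hY.aemeasurable]
    _ = ∫⁻ x', ∫⁻ y, φ (x', y) ∂(condDistrib (fun z => z.1 j) (fun z => z.2) μ x')
          ∂(μ.map fun z => z.2) := by
        rw [Measure.lintegral_compProd hφ]
    _ = ∫⁻ x', (μ.map fun z => z.2).rnDeriv volume x' *
          ∫⁻ y, φ (x', y) ∂(condDistrib (fun z => z.1 j) (fun z => z.2) μ x') := by
        have hm : Measurable fun x' =>
            ∫⁻ y, φ (x', y) ∂(condDistrib (fun z => z.1 j) (fun z => z.2) μ x') :=
          hφ.lintegral_kernel_prod_right'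
        conv_lhs => rw [← Measure.withDensity_rnDeriv_eq _ _ hX]
        rw [lintegral_withDensity_eq_lintegral_mul _ (Measure.measurable_rnDeriv _ _) hm]
        rfl
    _ ≤ ∫⁻ x', (U ⁻¹' K₀).indicator (fun _ => ENNReal.ofReal C₀) x' := by
        refine lintegral_mono_ae ?_
        filter_upwards [hmom P hP n hn x τ hxτ j] with x' hx'
        by_cases hu : x' ∈ U ⁻¹' K₀
        · simp only [φ, Set.indicator_of_mem hu, Pi.one_apply, one_mul]
          rw [mul_comm]
          -- The exceptional null set does not depend on `u`, so `u = U x'` may be substituted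
          -- although it varies with `x'`.
          refine hx' (fun l => ?_) _ hu
          have := hsmall _ hu l
          simpa [U, mul_inv_cancel_left₀ hh.ne'] using this
        · simp [φ, Set.indicator_of_notMem hu]
    _ = _ := by
        rw [lintegral_indicator_const (hU hK₀), hvol]

/-! ### Polynomial nets -/

theorem EuclideanSpace.norm_le_card_mul {d : ℕ} {x : Euc d} {ε : ℝ} (hε : 0 ≤ ε)
    (hx : ∀ i, |x i| ≤ ε) : ‖x‖ ≤ d * ε := by
  rw [EuclideanSpace.norm_eq, Real.sqrt_le_iff]
  refine ⟨by positivity, ?_⟩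
  calc ∑ i, ‖x i‖ ^ 2 ≤ ∑ _i : Fin d, ε ^ 2 :=
        Finset.sum_le_sum fun i _ => pow_le_pow_left₀ (norm_nonneg _) (hx i) 2
    _ = d * ε ^ 2 := by simp
    _ ≤ (d : ℝ) ^ 2 * ε ^ 2 := by
        gcongr
        exact_mod_cast Nat.le_self_pow two_ne_zero d
    _ = (d * ε) ^ 2 := by ring

theorem abs_sub_le_of_floor_eq {ε a b : ℝ} (hε : 0 < ε) (h : ⌊a / ε⌋ = ⌊b / ε⌋) :
    |a - b| ≤ ε := by
  have := Int.abs_sub_lt_one_of_floor_eq_floor h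
  rw [← sub_div, abs_div, abs_of_pos hε, div_lt_one hε] at this
  exact this.le

theorem floor_mem_Icc {ε B a : ℝ} (hε : 0 < ε) (h : |a| ≤ B) :
    ⌊a / ε⌋ ∈ Finset.Icc (-(⌊B / ε⌋ + 1)) (⌊B / ε⌋ + 1) := by
  rw [Finset.mem_Icc]
  have h1 := abs_le.1 h
  constructor
  · rw [Int.le_floor, le_div_iff₀ hε]
    push_cast
    have : B / ε < ⌊B / ε⌋ + 1 := Int.lt_floor_add_one _
    rw [div_lt_iff₀ hε] at this
    nlinarith
  · have : ⌊a / ε⌋ ≤ ⌊B / ε⌋ := Int.floor_le_floor (by gcongr; exact h1.2)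
    omega

/-- Bounded subsets of `ℝᵈ × ℝ^q` have internal nets of polynomial cardinality. -/
theorem exists_net_of_isBounded {d q : ℕ} {S : Set (Euc d × Euc q)}
    (hS : Bornology.IsBounded S) :
    ∃ D : ℝ, 0 < D ∧ ∀ ε : ℝ, 0 < ε → ε ≤ 1 → ∃ t : Finset (Euc d × Euc q), ↑t ⊆ S ∧
      (t.card : ℝ) ≤ (D / ε) ^ (d + q) ∧
      ∀ s ∈ S, ∃ k ∈ t, ‖k.1 - s.1‖ + ‖k.2 - s.2‖ ≤ ε := by
  classical
  obtain ⟨B, hB0, hB⟩ := hS.exists_pos_norm_le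
  -- Cells of side `ε / (d + q + 1)` suffice because the two norms add up to at most `d + q` sides.
  -- Choosing a representative in `S` from each occupied cell keeps the net inside `S`, where the
  -- continuity condition is available.
  refine ⟨2 * B * (d + q + 1) + 3, by positivity, fun lam hlam hlam1 => ?_⟩
  set ε := lam / (d + q + 1) with hε
  have hε0 : 0 < ε := by positivity
  let φ : Euc d × Euc q → (Fin d → ℤ) × (Fin q → ℤ) := fun s =>
    (fun i => ⌊s.1 i / ε⌋, fun i => ⌊s.2 i / ε⌋)
  let I := Finset.Icc (-(⌊B / ε⌋ + 1)) (⌊B / ε⌋ + 1)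
  let box := (Fintype.piFinset fun _ : Fin d => I) ×ˢ (Fintype.piFinset fun _ : Fin q => I)
  have hbox : ∀ s ∈ S, φ s ∈ box := by
    intro s hs
    have h1 : ‖s.1‖ ≤ B := (norm_fst_le s).trans (hB s hs)
    have h2 : ‖s.2‖ ≤ B := (norm_snd_le s).trans (hB s hs)
    refine Finset.mem_product.2 ⟨Fintype.mem_piFinset.2 fun i => ?_,
      Fintype.mem_piFinset.2 fun i => ?_⟩
    · exact floor_mem_Icc hε0 ((PiLp.norm_apply_le s.1 i).trans h1)
    · exact floor_mem_Icc hε0 ((PiLp.norm_apply_le s.2 i).trans h2)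
  have hrep : ∀ c : {c // c ∈ box.filter fun c => ∃ s ∈ S, φ s = c}, ∃ s ∈ S, φ s = c.1 := fun c =>
    (Finset.mem_filter.1 c.2).2
  choose rep hrepS hrepφ using hrep
  refine ⟨Finset.univ.image rep, ?_, ?_, ?_⟩
  · intro s hs
    obtain ⟨c, -, rfl⟩ := Finset.mem_image.1 (Finset.mem_coe.1 hs)
    exact hrepS c
  · have hfl : 0 ≤ ⌊B / ε⌋ := Int.floor_nonneg.2 (by positivity)
    have hI : (I.card : ℝ) ≤ (2 * B * (d + q + 1) + 3) / lam := by
      have h1 : (I.card : ℤ) = 2 * ⌊B / ε⌋ + 3 := by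
        rw [Int.card_Icc, Int.toNat_of_nonneg (by omega)]
        ring
      have h2 : (I.card : ℝ) = 2 * (⌊B / ε⌋ : ℝ) + 3 := by exact_mod_cast h1
      rw [h2]
      have h3 : (⌊B / ε⌋ : ℝ) ≤ B / ε := Int.floor_le _
      have h4 : B / ε = B * (d + q + 1) / lam := by rw [hε, div_div_eq_mul_div]
      have h5 : (3 : ℝ) ≤ 3 / lam := by rw [le_div_iff₀ hlam]; linarith
      rw [add_div]
      calc 2 * (⌊B / ε⌋ : ℝ) + 3 ≤ 2 * (B * (d + q + 1) / lam) + 3 / lam := by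
            rw [← h4]; linarith
        _ = _ := by ring
    calc ((Finset.univ.image rep).card : ℝ)
        ≤ (Finset.univ : Finset {c // c ∈ box.filter fun c => ∃ s ∈ S, φ s = c}).card := by
          exact_mod_cast Finset.card_image_le
      _ ≤ box.card := by
          rw [Finset.card_univ, Fintype.card_coe]
          exact_mod_cast Finset.card_filter_le _ _
      _ = (I.card : ℝ) ^ (d + q) := by
          simp [box, Finset.card_product, pow_add]
      _ ≤ _ := pow_le_pow_left₀ (Nat.cast_nonneg _) hI _
  · intro s hs
    have hc : φ s ∈ box.filter fun c => ∃ s ∈ S, φ s = c :=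
      Finset.mem_filter.2 ⟨hbox s hs, s, hs, rfl⟩
    refine ⟨rep ⟨φ s, hc⟩, Finset.mem_image_of_mem _ (Finset.mem_univ _), ?_⟩
    have heq := hrepφ ⟨φ s, hc⟩
    set k := rep ⟨φ s, hc⟩
    have h1 : ‖k.1 - s.1‖ ≤ d * ε := EuclideanSpace.norm_le_card_mul hε0.le fun i =>
      abs_sub_le_of_floor_eq hε0 (congrFun (congrArg Prod.fst heq) i)
    have h2 : ‖k.2 - s.2‖ ≤ q * ε := EuclideanSpace.norm_le_card_mul hε0.le fun i =>
      abs_sub_le_of_floor_eq hε0 (congrFun (congrArg Prod.snd heq) i)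
    have h3 : (d + q + 1) * ε = lam := by rw [hε]; field_simp
    nlinarith

/-! ### Uniform second moment bound -/

theorem supOn_le_ofReal_iff {d q : ℕ} {S : Set (Euc d × Euc q)} {f : Euc d → Euc q → ℝ} {c : ℝ}
    (hc : 0 ≤ c) : supOn S f ≤ ENNReal.ofReal c ↔ ∀ s ∈ S, f s.1 s.2 ≤ c := by
  simp only [supOn, iSup_le_iff, ENNReal.ofReal_le_ofReal_iff hc]

theorem tendsto_zero_of_limsup_eq_zero {u : ℕ → ℝ≥0∞} (h : limsup u atTop = 0) :
    Tendsto u atTop (𝓝 0) :=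
  tendsto_of_le_liminf_of_limsup_le zero_le h.le

/-- The second moments of `b_{n,j}(x, τ)` are at most of the order `hᵈ`, uniformly. -/
theorem exists_second_moment_bound {J L d q : ℕ} {𝓜 : Set (ProbabilityMeasure (Obs J L d))}
    {S : Set (Euc d × Euc q)}
    (hX : ∀ P ∈ 𝓜, ((P : Measure (Obs J L d)).map fun z => z.2) ≪ volume)
    {h : ℕ → ℝ} {β : BetaFun J L d q}
    (hβ : ∀ P n x τ j, Measurable fun yu : Euc L × Euc d => β P n x τ j yu.1 yu.2)
    {K₀ : Set (Euc d)} (hK₀ : IsCompact K₀) (hA2 : KernelType 𝓜 S β K₀) {C₀ ε₀ : ℝ} (hε₀ : 0 < ε₀)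
    (hmom : CondMoment 𝓜 S β K₀ C₀ ε₀) {j : Fin J} {c : ℝ} (hc : 0 ≤ c)
    (hfourth : ∀ᶠ n in atTop, ∀ P ∈ 𝓜, outerExp (P : Measure (Obs J L d))
      (fun z => supOn S fun x τ => bFun β h P n j z x τ ^ 4) < ENNReal.ofReal c)
    {s₂ : ℝ} (hs₂ : s₂ ≤ 0) (hh : ∀ n : ℕ, 1 ≤ n → h n = (n : ℝ) ^ s₂) :
    ∃ V : ℝ, 0 < V ∧ ∀ᶠ n in atTop, ∀ P ∈ 𝓜, ∀ s ∈ S,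
      ∫⁻ z, ENNReal.ofReal (bFun β h P n j z s.1 s.2 ^ 2) ∂(P : Measure (Obs J L d)) ≤
        ENNReal.ofReal (V * h n ^ d) := by
  rcases hs₂.eq_or_lt with rfl | hs
  -- Here `h = 1`, so `K₀` need not fit in the cube where the conditional moment is controlled; `u ^
  -- 2 ≤ 1 + u ^ 4` and the envelope are enough.
  · refine ⟨1 + c, by positivity, ?_⟩
    filter_upwards [hfourth, eventually_ge_atTop 1] with n h4 hn P hP s hs
    rw [hh n hn, Real.rpow_zero, one_pow, mul_one]
    obtain ⟨g, -, hZ, hle⟩ := exists_measurable_majorant (h4 P hP)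
    calc ∫⁻ z, ENNReal.ofReal (bFun β h P n j z s.1 s.2 ^ 2) ∂(P : Measure (Obs J L d))
        ≤ ∫⁻ z, (1 + g z) ∂(P : Measure (Obs J L d)) := by
          refine lintegral_mono fun z => ?_
          calc ENNReal.ofReal (bFun β h P n j z s.1 s.2 ^ 2)
              ≤ ENNReal.ofReal (1 + bFun β h P n j z s.1 s.2 ^ 4) :=
                ENNReal.ofReal_le_ofReal (by
                  nlinarith [sq_nonneg (bFun β h P n j z s.1 s.2 ^ 2 - 1),
                    sq_nonneg (bFun β h P n j z s.1 s.2)])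
            _ = 1 + ENNReal.ofReal (bFun β h P n j z s.1 s.2 ^ 4) := by
                rw [ENNReal.ofReal_add zero_le_one (by positivity), ENNReal.ofReal_one]
            _ ≤ 1 + g z := by
                gcongr
                exact (le_iSup₂ (f := fun (s : Euc d × Euc q) (_ : s ∈ S) =>
                  ENNReal.ofReal (bFun β h P n j z s.1 s.2 ^ 4)) s hs).trans (hZ z)
      _ = 1 + ∫⁻ z, g z ∂(P : Measure (Obs J L d)) := by
          rw [lintegral_add_left measurable_const]
          simp
      _ ≤ ENNReal.ofReal (1 + c) := by
          rw [ENNReal.ofReal_add zero_le_one hc, ENNReal.ofReal_one]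
          gcongr
  · obtain ⟨B, hB0, hB⟩ := hK₀.isBounded.exists_pos_norm_le
    refine ⟨max C₀ 0 * (volume K₀).toReal + 1, by positivity, ?_⟩
    have hlim : Tendsto (fun n : ℕ => (n : ℝ) ^ s₂ * B) atTop (𝓝 0) := by
      have := (tendsto_rpow_neg_atTop (neg_pos.2 hs)).comp tendsto_natCast_atTop_atTop
      simpa [Function.comp_def] using this.mul_const B
    filter_upwards [eventually_ge_atTop 1, hlim.eventually_lt_const hε₀] with n hn hlt P hP s hs
    have hn' : (0 : ℝ) < n := by exact_mod_cast hn
    have hpos : 0 < h n := by rw [hh n hn]; positivity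
    rw [← hh n hn] at hlt
    refine (lintegral_bFun_sq_le hβ hK₀.measurableSet hA2 hmom hP (hX P hP) hn hpos ?_ j
      (x := s.1) (τ := s.2) hs).trans ?_
    · intro u hu l
      rw [abs_mul, abs_of_pos hpos]
      have : |u l| ≤ B := (PiLp.norm_apply_le u l).trans (hB u hu)
      exact (mul_le_mul_of_nonneg_left this hpos.le).trans hlt.le
    · have hvol : volume K₀ = ENNReal.ofReal (volume K₀).toReal :=
        (ENNReal.ofReal_toReal hK₀.measure_lt_top.ne).symm
      have hC : ENNReal.ofReal C₀ ≤ ENNReal.ofReal (max C₀ 0) :=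
        ENNReal.ofReal_le_ofReal (le_max_left _ _)
      rw [hvol, ENNReal.toReal_ofReal ENNReal.toReal_nonneg]
      refine (mul_le_mul_left hC _).trans ?_
      rw [← ENNReal.ofReal_mul (by positivity), ← ENNReal.ofReal_mul (by positivity)]
      refine ENNReal.ofReal_le_ofReal ?_
      have : 0 < h n ^ d := by positivity
      nlinarith

/-! ### Normalized processes and choice of rates -/

theorem integral_pi_sum_comp_eval {Ω : Type*} [MeasurableSpace Ω] {μ : Measure Ω}
    [IsProbabilityMeasure μ] {u : Ω → ℝ} (hu : Integrable u μ) (n : ℕ) :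
    ∫ w, ∑ i, u (w i) ∂(Measure.pi fun _ : Fin n => μ) = n * ∫ z, u z ∂μ := by
  rw [integral_finsetSum _ fun i _ => integrable_comp_eval (μ := fun _ : Fin n => μ) (i := i) hu,
    Finset.sum_congr rfl fun i _ => integral_comp_eval (μ := fun _ : Fin n => μ) (i := i)
      hu.aestronglyMeasurable]
  simp

theorem sqrt_mul_gHat_sub_integral {J L d q : ℕ} (β : BetaFun J L d q) {h : ℕ → ℝ}
    (P : ProbabilityMeasure (Obs J L d)) {n : ℕ} (hpos : 0 < n * h n ^ d) (j : Fin J)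
    (w : Fin n → Obs J L d) (x : Euc d) (τ : Euc q)
    (hint : Integrable (fun z => bFun β h P n j z x τ) (P : Measure (Obs J L d))) :
    √(n * h n ^ d) * (gHat β h P n j w x τ - ∫ w', gHat β h P n j w' x τ ∂(sampleLaw P n)) =
      (∑ i, bFun β h P n j (w i) x τ - n * ∫ z, bFun β h P n j z x τ ∂(P : Measure (Obs J L d))) /
        √(n * h n ^ d) := by
  have hE : ∫ w', gHat β h P n j w' x τ ∂(sampleLaw P n) = (n * h n ^ d)⁻¹ *
      (n * ∫ z, bFun β h P n j z x τ ∂(P : Measure (Obs J L d))) := by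
    simp only [gHat, sampleLaw]
    rw [integral_const_mul, integral_pi_sum_comp_eval hint]
  rw [hE, gHat, ← mul_sub, ← mul_assoc]
  have h1 : √(n * h n ^ d) * √(n * h n ^ d) = n * h n ^ d := Real.mul_self_sqrt hpos.le
  have h2 : √(n * h n ^ d) ≠ 0 := (Real.sqrt_pos.2 hpos).ne'
  rw [eq_div_iff h2]
  nth_rewrite 2 [← h1]
  field_simp

theorem sqrt_mul_gHat_comp_sub_integral {J L d q : ℕ} (β : BetaFun J L d q) {h : ℕ → ℝ}
    (P : ProbabilityMeasure (Obs J L d)) {n : ℕ} (hn : 1 ≤ n) (hpos : 0 < n * h n ^ d) (j : Fin J)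
    (w : Fin n → Obs J L d) (κ : Fin n → Fin n) (x : Euc d) (τ : Euc q) :
    √(n * h n ^ d) * (gHat β h P n j (w ∘ κ) x τ -
        ∫ κ', gHat β h P n j (w ∘ κ') x τ ∂(bootLaw n)) =
      (∑ i, bFun β h P n j (w (κ i)) x τ - ∑ i, bFun β h P n j (w i) x τ) / √(n * h n ^ d) := by
  have : NeZero n := ⟨by omega⟩
  have := isProbabilityMeasure_uniformOn (Set.finite_univ (α := Fin n)) Set.univ_nonempty
  have hint : Integrable (fun i => bFun β h P n j (w i) x τ)
      (uniformOn (Set.univ : Set (Fin n))) := Integrable.of_finite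
  have hE : ∫ κ', gHat β h P n j (w ∘ κ') x τ ∂(bootLaw n) = (n * h n ^ d)⁻¹ *
      ∑ i, bFun β h P n j (w i) x τ := by
    simp only [gHat, bootLaw_eq_pi, Function.comp_apply]
    rw [integral_const_mul, integral_pi_sum_comp_eval hint, card_mul_integral_uniformOn_univ hn]
  rw [hE, gHat, ← mul_sub, ← mul_assoc]
  have h1 : √(n * h n ^ d) * √(n * h n ^ d) = n * h n ^ d := Real.mul_self_sqrt hpos.le
  have h2 : √(n * h n ^ d) ≠ 0 := (Real.sqrt_pos.2 hpos).ne'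
  rw [eq_div_iff h2]
  nth_rewrite 2 [← h1]
  simp only [Function.comp_apply]
  field_simp

/-- If the exponent were nonpositive, the sequence in `hrate` would be a nonnegative power of `n`,
hence at least 1. Positivity makes `n h^{2d}` outgrow every power of `log n`. -/
theorem bandwidth_exponent_pos {d : ℕ} {h : ℕ → ℝ} {s₂ : ℝ} (hs₂ : s₂ ≤ 0)
    (hh : ∀ n : ℕ, 1 ≤ n → h n = (n : ℝ) ^ s₂) {ν : ℝ} (hν : 0 < ν)
    (hrate : Tendsto (fun n : ℕ => (n : ℝ) ^ (-(1 / 2) : ℝ) * h n ^ (-(d : ℝ) - ν)) atTop (𝓝 0)) :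
    0 < 1 / 2 + s₂ * d := by
  by_contra hcon
  have hexp : 0 ≤ -(1 / 2) + s₂ * (-(d : ℝ) - ν) := by nlinarith
  have hge : ∀ᶠ n : ℕ in atTop, 1 ≤ (n : ℝ) ^ (-(1 / 2) : ℝ) * h n ^ (-(d : ℝ) - ν) := by
    filter_upwards [eventually_ge_atTop 1] with n hn
    have hn' : (1 : ℝ) ≤ n := by exact_mod_cast hn
    rw [hh n hn, ← Real.rpow_mul (by positivity), ← Real.rpow_add (by positivity)]
    exact Real.one_le_rpow hn' hexp
  linarith [ge_of_tendsto hrate hge]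

/-- With probability tending to one uniformly over the class, the kernel-type process and its
bootstrap analogue are of the order `√(log n)` uniformly over the index set. -/
theorem exists_uniform_good_samples {J L d q : ℕ} {𝓜 : Set (ProbabilityMeasure (Obs J L d))}
    {S : Set (Euc d × Euc q)} (hS : IsCompact S)
    (hX : ∀ P ∈ 𝓜, ((P : Measure (Obs J L d)).map fun z => z.2) ≪ volume)
    {h : ℕ → ℝ} {β : BetaFun J L d q}
    (hβ : ∀ P n x τ j, Measurable fun yu : Euc L × Euc d => β P n x τ j yu.1 yu.2)
    {K₀ : Set (Euc d)} (hK₀ : IsCompact K₀) (hA2 : KernelType 𝓜 S β K₀) {C₀ ε₀ : ℝ} (hε₀ : 0 < ε₀)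
    (hmom : CondMoment 𝓜 S β K₀ C₀ ε₀) {j : Fin J} {C γ s₁ : ℝ} (hC : 0 < C) (hγ : 0 < γ)
    (hcont : LocalL2Cont 𝓜 S h β j C γ s₁)
    (hfourth : limsup (fun n => ⨆ P ∈ 𝓜, outerExp (P : Measure (Obs J L d))
        (fun z => supOn S fun x τ => bFun β h P n j z x τ ^ 4)) atTop ≤ ENNReal.ofReal C)
    {s₂ : ℝ} (hs₂ : s₂ ≤ 0) (hh : ∀ n : ℕ, 1 ≤ n → h n = (n : ℝ) ^ s₂)
    {ν : ℝ} (hν : 0 < ν)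
    (hrate : Tendsto (fun n : ℕ => (n : ℝ) ^ (-(1 / 2) : ℝ) * h n ^ (-(d : ℝ) - ν)) atTop (𝓝 0)) :
    ∃ M : ℝ, 0 < M ∧ ∃ ρ : ℕ → ℝ≥0∞, Tendsto ρ atTop (𝓝 0) ∧ ∀ᶠ n in atTop, ∀ P ∈ 𝓜,
      ∃ W : Set (Fin n → Obs J L d), sampleLaw P n Wᶜ ≤ ρ n ∧ ∀ w ∈ W,
        (∀ s ∈ S, |√(n * h n ^ d) * (gHat β h P n j w s.1 s.2 -
          ∫ w', gHat β h P n j w' s.1 s.2 ∂(sampleLaw P n))| ≤ M * √(Real.log n)) ∧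
        bootLaw n {κ | ∃ s ∈ S, M * √(Real.log n) <
          |√(n * h n ^ d) * (gHat β h P n j (w ∘ κ) s.1 s.2 -
            ∫ κ', gHat β h P n j (w ∘ κ') s.1 s.2 ∂(bootLaw n))|} ≤ ρ n := by
  set c := C + 1 with hc
  have hc0 : 0 < c := by positivity
  have h4 : ∀ᶠ n in atTop, ∀ P ∈ 𝓜, outerExp (P : Measure (Obs J L d))
      (fun z => supOn S fun x τ => bFun β h P n j z x τ ^ 4) < ENNReal.ofReal c := by
    have hlt : ENNReal.ofReal C < ENNReal.ofReal c :=
      (ENNReal.ofReal_lt_ofReal_iff hc0).2 (by linarith)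
    filter_upwards [eventually_lt_of_limsup_lt (hfourth.trans_lt hlt)] with n hn P hP
    exact (le_iSup₂ (f := fun (P : ProbabilityMeasure (Obs J L d)) (_ : P ∈ 𝓜) =>
      outerExp (P : Measure (Obs J L d))
        (fun z => supOn S fun x τ => bFun β h P n j z x τ ^ 4)) P hP).trans_lt hn
  obtain ⟨V, hV0, hV⟩ := exists_second_moment_bound hX hβ hK₀ hA2 hε₀ hmom hc0.le h4 hs₂ hh
  obtain ⟨D, hD0, hD⟩ := exists_net_of_isBounded hS.isBounded
  have hθ := bandwidth_exponent_pos hs₂ hh hν hrate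
  set θ := 1 / 2 + s₂ * d with hθdef
  -- The mesh `n ^ (-p)` makes the squared increments `O(n ^ (-2))` whatever the sign of `s₁`, so `n
  -- * √e` stays bounded.
  set p := (2 * |s₁| + 2) / γ with hp
  have hp0 : 0 < p := by positivity
  have hpγ : p * γ = 2 * |s₁| + 2 := div_mul_cancel₀ _ hγ.ne'
  -- The net has `O(n ^ (p * (d + q)))` points; one more power of `n` makes the union bound `O(1 /
  -- n)`. The next constant satisfies `M - 2 * V - 2 = m`.
  set m := p * ((d + q : ℕ) : ℝ) + 1 with hm
  have hm0 : 0 < m := by positivity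
  set M := 2 * V + 2 + m with hM
  have hM0 : 0 < M := by positivity
  have hlog : Tendsto (fun n : ℕ => Real.log n) atTop atTop :=
    Real.tendsto_log_atTop.comp tendsto_natCast_atTop_atTop
  let ρ : ℕ → ℝ≥0∞ := fun n =>
    ENNReal.ofReal (4 * D ^ (d + q) / n) + ENNReal.ofReal (c / Real.log n)
  have hρ : Tendsto ρ atTop (𝓝 0) := by
    have h1 : Tendsto (fun n : ℕ => 4 * D ^ (d + q) / (n : ℝ)) atTop (𝓝 0) :=
      tendsto_const_div_atTop_nhds_zero_nat _
    have h2 : Tendsto (fun n : ℕ => c / Real.log n) atTop (𝓝 0) := hlog.const_div_atTop c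
    simpa using (ENNReal.tendsto_ofReal h1).add (ENNReal.tendsto_ofReal h2)
  have hcube : ∀ᶠ n : ℕ in atTop, 16 * Real.log n ^ 3 ≤ (n : ℝ) ^ (2 * θ) := by
    have h1 := (isLittleO_log_rpow_rpow_atTop 3 (show 0 < 2 * θ by positivity)).comp_tendsto
      tendsto_natCast_atTop_atTop
    filter_upwards [h1.bound (show (0 : ℝ) < 1 / 16 by norm_num), eventually_ge_atTop 1]
      with n hn hn1
    have hl : 0 ≤ Real.log n := Real.log_natCast_nonneg n
    simp only [Function.comp_apply, Real.norm_eq_abs] at hn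
    rw [abs_of_nonneg (by positivity), abs_of_nonneg (by positivity)] at hn
    have h3 : Real.log n ^ (3 : ℝ) = Real.log n ^ 3 := by exact_mod_cast Real.rpow_natCast _ 3
    rw [h3] at hn
    linarith
  refine ⟨11 * M, by positivity, ρ, hρ, ?_⟩
  filter_upwards [h4, hV, hcube, eventually_ge_atTop 1, hlog.eventually_ge_atTop 1,
    hlog.eventually_ge_atTop c, hlog.eventually_ge_atTop (8 * C)]
    with n h4n hVn hcuben hn hL1 hLc hLC P hP
  have hn1 : (1 : ℝ) ≤ n := by exact_mod_cast hn
  have hn0 : (0 : ℝ) < n := by linarith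
  have hhn := hh n hn
  have hpos : 0 < h n := by rw [hhn]; positivity
  set ℓ := Real.log n with hℓ
  have hℓ0 : 0 < ℓ := by linarith
  set K := √ℓ with hKdef
  have hK0 : 0 ≤ K := Real.sqrt_nonneg _
  have hK2 : K ^ 2 = ℓ := Real.sq_sqrt hℓ0.le
  have hnh : 0 < n * h n ^ d := by positivity
  set R := √(n * h n ^ d) with hRdef
  have hR0 : 0 < R := Real.sqrt_pos.2 hnh
  have hR2 : R ^ 2 = n * h n ^ d := Real.sq_sqrt hnh.le
  have hR2' : R ^ 2 = (n : ℝ) ^ (1 / 2 + θ) := by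
    rw [hR2, hhn, ← Real.rpow_natCast, ← Real.rpow_mul hn0.le, ← Real.rpow_one_add' hn0.le]
    · congr 1; rw [hθdef]; ring
    · have : 1 + s₂ * d = 1 / 2 + θ := by rw [hθdef]; ring
      rw [this]; positivity
  -- A compromise: `n / T ^ 4 = 1 / ℓ` must vanish, while `2 * T * K ≤ R` must hold, which is
  -- `hcube`.
  set T := √√(n * ℓ) with hTdef
  have hT0 : 0 < T := Real.sqrt_pos.2 (Real.sqrt_pos.2 (by positivity))
  have hT2 : T ^ 2 = √(n * ℓ) := Real.sq_sqrt (Real.sqrt_nonneg _)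
  have hT4 : T ^ 4 = n * ℓ := by
    rw [show T ^ 4 = (T ^ 2) ^ 2 by ring, hT2, Real.sq_sqrt (by positivity)]
  have hTR : 2 * T * K ≤ R := by
    refine le_of_pow_le_pow_left₀ four_ne_zero hR0.le ?_
    calc (2 * T * K) ^ 4 = 16 * T ^ 4 * (K ^ 2) ^ 2 := by ring
      _ = n * (16 * ℓ ^ 3) := by rw [hT4, hK2]; ring
      _ ≤ n * (n : ℝ) ^ (2 * θ) := by gcongr
      _ = (R ^ 2) ^ 2 := by
          rw [hR2', ← Real.rpow_natCast, ← Real.rpow_mul hn0.le, ← Real.rpow_one_add' hn0.le]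
          · congr 1; push_cast; ring
          · positivity
      _ = R ^ 4 := by ring
  set lam := (n : ℝ) ^ (-p) with hlam
  have hlam0 : 0 < lam := by positivity
  have hlam1 : lam ≤ 1 := Real.rpow_le_one_of_one_le_of_nonpos hn1 (by linarith)
  obtain ⟨t, htS, htcard, htcover⟩ := hD lam hlam0 hlam1
  -- The factor 2 yields the strict inequality required for a measurable majorant.
  set e := 2 * (C * ((n : ℝ) ^ s₁) ^ 2 * lam ^ γ) with he
  have he0 : 0 < e := by positivity
  have hen : n ^ 2 * e ≤ 2 * C := by
    have h1 : ((n : ℝ) ^ s₁) ^ 2 * lam ^ γ * n ^ 2 = (n : ℝ) ^ (2 * s₁ - 2 * |s₁|) := by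
      rw [hlam, ← Real.rpow_mul hn0.le, ← Real.rpow_natCast, ← Real.rpow_natCast,
        ← Real.rpow_mul hn0.le, ← Real.rpow_add hn0, ← Real.rpow_add hn0]
      congr 1
      push_cast
      linarith
    have h2 : (n : ℝ) ^ (2 * s₁ - 2 * |s₁|) ≤ 1 :=
      Real.rpow_le_one_of_one_le_of_nonpos hn1 (by linarith [le_abs_self s₁])
    calc n ^ 2 * e = 2 * C * (((n : ℝ) ^ s₁) ^ 2 * lam ^ γ * n ^ 2) := by rw [he]; ring
      _ ≤ 2 * C * 1 := by rw [h1]; gcongr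
      _ = 2 * C := mul_one _
  have hR1 : 1 ≤ R ^ 2 := by rw [hR2']; exact Real.one_le_rpow hn1 (by positivity)
  have heT : n * (√e + c / T ^ 3) ≤ K * R := by
    have h1 : n * √e ≤ K * R / 2 := by
      refine le_of_pow_le_pow_left₀ two_ne_zero (by positivity) ?_
      rw [mul_pow, Real.sq_sqrt he0.le, div_pow, mul_pow, hK2]
      linarith [le_mul_of_one_le_right hℓ0.le hR1]
    have h2 : n * (c / T ^ 3) ≤ K * R / 2 := by
      have h3 : n * (c / T ^ 3) = c * T / ℓ := by
        rw [eq_div_iff hℓ0.ne', mul_div_assoc', div_mul_eq_mul_div, div_eq_iff (by positivity)]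
        calc n * c * ℓ = c * (n * ℓ) := by ring
          _ = c * T ^ 4 := by rw [hT4]
          _ = c * T * T ^ 3 := by ring
      have h5 : c * T / ℓ ≤ T := by
        rw [div_le_iff₀ hℓ0, mul_comm]
        exact mul_le_mul_of_nonneg_left hLc hT0.le
      rw [h3]
      calc c * T / ℓ ≤ T := h5
        _ ≤ T * K ^ 2 := le_mul_of_one_le_right hT0.le (hL1.trans hK2.ge)
        _ = K * (2 * T * K) / 2 := by ring
        _ ≤ K * R / 2 := by gcongr
    linarith
  have hf : ∀ s ∈ S, Measurable fun z => bFun β h P n j z s.1 s.2 := fun s _ =>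
    measurable_bFun hβ h P n j s.1 s.2
  have hsq : ∀ s ∈ S, Integrable (fun z => bFun β h P n j z s.1 s.2 ^ 2) (P : Measure _) ∧
      ∫ z, bFun β h P n j z s.1 s.2 ^ 2 ∂(P : Measure _) ≤ V * h n ^ d := fun s hs =>
    integrable_and_integral_le_of_lintegral_le ((hf s hs).pow_const 2) (fun z => sq_nonneg _)
      (by positivity) (hVn P hP s hs)
  obtain ⟨W, hW, hWgood⟩ := exists_good_samples (P : Measure (Obs J L d)) hf htS
    (N := fun k => {s ∈ S | ‖k.1 - s.1‖ + ‖k.2 - s.2‖ ≤ lam}) (fun k _ => Set.sep_subset _ _)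
    (fun s hs => by
      obtain ⟨k, hk, hks⟩ := htcover s hs
      exact ⟨k, hk, hs, hks⟩)
    hn hc0 he0 hT0 hV0.le hK0 hR0 hM0.le (h4n P hP)
    (fun k hk => by
      refine (hcont P hP n hn k.1 k.2 (htS hk) lam hlam0).trans_lt ?_
      refine (ENNReal.ofReal_lt_ofReal_iff he0).2 ?_
      linarith)
    (fun k hk => by
      rw [hR2]
      calc n * ∫ z, bFun β h P n j z k.1 k.2 ^ 2 ∂(P : Measure _) ≤ n * (V * h n ^ d) := by
            gcongr
            exact (hsq k (htS hk)).2
        _ = _ := by ring)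
    (fun k hk => (hsq k (htS hk)).1) hTR heT
  have hnet : ∀ x : ℝ, m ≤ x → (t.card : ℝ≥0∞) * ENNReal.ofReal (4 * Real.exp (-(x * K ^ 2))) ≤
      ENNReal.ofReal (4 * D ^ (d + q) / n) := by
    intro x hx
    rw [← ENNReal.ofReal_natCast, ← ENNReal.ofReal_mul (Nat.cast_nonneg _)]
    refine ENNReal.ofReal_le_ofReal ?_
    have h1 : Real.exp (-(x * K ^ 2)) ≤ (n : ℝ) ^ (-m) := by
      rw [hK2, Real.rpow_def_of_pos hn0]
      refine Real.exp_le_exp.2 ?_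
      linarith [mul_le_mul_of_nonneg_right hx hℓ0.le]
    calc (t.card : ℝ) * (4 * Real.exp (-(x * K ^ 2)))
        ≤ (D / lam) ^ (d + q) * (4 * (n : ℝ) ^ (-m)) := by gcongr
      _ = 4 * D ^ (d + q) * (lam⁻¹ ^ (d + q) * (n : ℝ) ^ (-m)) := by
          rw [div_eq_mul_inv, mul_pow]; ring
      _ = 4 * D ^ (d + q) / n := by
          rw [hlam, Real.rpow_neg hn0.le, inv_inv, ← Real.rpow_natCast ((n : ℝ) ^ p),
            ← Real.rpow_mul hn0.le, ← Real.rpow_add hn0, div_eq_mul_inv, ← Real.rpow_neg_one]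
          congr 2
          rw [hm]; ring
  refine ⟨W, ?_, fun w hw => ⟨fun s hs => ?_, ?_⟩⟩
  · refine hW.trans (add_le_add (hnet _ (by rw [hM]; linarith)) ?_)
    rw [← ENNReal.ofReal_natCast, ← ENNReal.ofReal_mul (Nat.cast_nonneg _), hT4]
    refine ENNReal.ofReal_le_ofReal (le_of_eq ?_)
    change _ = c / ℓ
    field_simp
  · have hint : Integrable (fun z => bFun β h P n j z s.1 s.2) (P : Measure (Obs J L d)) :=
      (integrable_and_integral_abs_le_sqrt (hf s hs) (by positivity) (hVn P hP s hs)).1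
    rw [sqrt_mul_gHat_sub_integral β P hnh j w s.1 s.2 hint, abs_div, abs_of_pos hR0,
      div_le_iff₀ hR0]
    refine ((hWgood w hw).1 s hs).trans ?_
    rw [mul_assoc _ K R]
    have : 0 ≤ K * R := by positivity
    exact mul_le_mul_of_nonneg_right (by linarith) this
  · refine le_trans (measure_mono ?_) (((hWgood w hw).2.trans (hnet M (by linarith))).trans
      le_self_add)
    rintro κ ⟨s, hs, hlt⟩
    refine ⟨s, hs, ?_⟩
    rwa [sqrt_mul_gHat_comp_sub_integral β P hn hnh j w κ s.1 s.2, abs_div, abs_of_pos hR0,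
      lt_div_iff₀ hR0, mul_assoc _ K R] at hlt

/-! ### Conclusion for the estimators and the bootstrap -/

theorem lemma2 {J L d q : ℕ}
    (𝓜 : Set (ProbabilityMeasure (Obs J L d)))
    (𝒳 : Set (Euc d)) (𝒯 : Set (Euc q)) (hS : IsCompact (𝒳 ×ˢ 𝒯))
    (hX : ∀ P ∈ 𝓜, ((P : Measure (Obs J L d)).map fun z => z.2) ≪ volume)
    (h : ℕ → ℝ) (r : ℕ → Fin J → ℝ)
    (vhat sigmahat : Estimator J L d q) (vstar sigmastar : BootEstimator J L d q)
    (v : ProbabilityMeasure (Obs J L d) → ℕ → Fin J → Euc d → Euc q → ℝ)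
    (β : BetaFun J L d q)
    (hβ : ∀ P n x τ j, Measurable fun yu : Euc L × Euc d => β P n x τ j yu.1 yu.2)
    (hA1 : AsympLinear 𝓜 (𝒳 ×ˢ 𝒯) h r β vhat sigmahat v)
    (K₀ : Set (Euc d)) (hK₀ : IsCompact K₀)
    (hA2 : KernelType 𝓜 (𝒳 ×ˢ 𝒯) β K₀)
    (C₀ ε₀ : ℝ) (hε₀ : 0 < ε₀)
    (hmom : CondMoment 𝓜 (𝒳 ×ˢ 𝒯) β K₀ C₀ ε₀)
    (C γ s₁ : Fin J → ℝ) (hC : ∀ j, 0 < C j) (hγ : ∀ j, 0 < γ j)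
    (hcont : ∀ j, LocalL2Cont 𝓜 (𝒳 ×ˢ 𝒯) h β j (C j) (γ j) (s₁ j))
    (hfourth : ∀ j, limsup (fun n => ⨆ P ∈ 𝓜, outerExp (P : Measure (Obs J L d))
        (fun z => supOn (𝒳 ×ˢ 𝒯) fun x τ => bFun β h P n j z x τ ^ 4)) atTop
        ≤ ENNReal.ofReal (C j))
    (s₂ : ℝ) (hs₂ : s₂ ≤ 0) (hh : ∀ n : ℕ, 1 ≤ n → h n = (n : ℝ) ^ s₂)
    (ν : ℝ) (hν : 0 < ν)
    (hrate : Tendsto (fun n : ℕ => (n : ℝ) ^ (-(1 / 2) : ℝ) * h n ^ (-(d : ℝ) - ν)) atTop (𝓝 0)) :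
    UnifRate 𝓜 (𝒳 ×ˢ 𝒯) r vhat sigmahat v ∧
      (BootAsympLinear 𝓜 (𝒳 ×ˢ 𝒯) h r β vhat vstar sigmastar →
        BootScale 𝓜 (𝒳 ×ˢ 𝒯) sigmahat sigmastar →
        BootUnifRate 𝓜 (𝒳 ×ˢ 𝒯) r vhat vstar sigmastar) := by
  have hgood := fun j => exists_uniform_good_samples hS hX hβ hK₀ hA2 hε₀ hmom (hC j) (hγ j)
    (hcont j) (hfourth j) hs₂ hh hν hrate
  have hlog : Tendsto (fun n : ℕ => Real.log n) atTop atTop :=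
    Real.tendsto_log_atTop.comp tendsto_natCast_atTop_atTop
  -- As `h ≤ 1`, the linearization error is absorbed into the rate.
  have hsmall : ∀ᶠ n : ℕ in atTop, √(h n ^ d) ≤ √(Real.log n) := by
    filter_upwards [eventually_ge_atTop 1, hlog.eventually_ge_atTop 1] with n hn hl
    have hn1 : (1 : ℝ) ≤ n := by exact_mod_cast hn
    refine Real.sqrt_le_sqrt (le_trans ?_ hl)
    rw [hh n hn]
    exact pow_le_one₀ (by positivity) (Real.rpow_le_one_of_one_le_of_nonpos hn1 hs₂)
  have hbound : ∀ {ρ a g B b l : ℝ}, |ρ * a - g| ≤ b → |g| ≤ B * l → b ≤ l →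
      ρ * |a| ≤ (B + 1) * l := by
    intro ρ a g B b l h1 h2 h3
    calc ρ * |a| ≤ |ρ| * |a| := mul_le_mul_of_nonneg_right (le_abs_self ρ) (abs_nonneg a)
      _ = |(ρ * a - g) + g| := by rw [sub_add_cancel, abs_mul]
      _ ≤ |ρ * a - g| + |g| := abs_add_le _ _
      _ ≤ (B + 1) * l := by linarith
  constructor
  · intro j
    obtain ⟨M, hM, ρ, hρ, hev⟩ := hgood j
    intro a ha
    refine ⟨M + 1, by positivity, ?_⟩
    have hlin := tendsto_zero_of_limsup_eq_zero (hA1 j 1 one_pos)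
    have hsum := hρ.add hlin
    rw [add_zero] at hsum
    refine lt_of_eq_of_lt (Tendsto.limsup_eq ?_) (ENNReal.ofReal_pos.2 ha)
    refine tendsto_of_tendsto_of_tendsto_of_le_of_le' tendsto_const_nhds hsum
      (Eventually.of_forall fun _ => zero_le) ?_
    filter_upwards [hev, hsmall] with n hn hsn
    refine iSup₂_le fun P hP => ?_
    obtain ⟨W, hW, hWg⟩ := hn P hP
    refine le_trans (le_trans (measure_mono ?_) (measure_union_le _ _)) (add_le_add hW
      (le_iSup₂ (f := fun (P : ProbabilityMeasure (Obs J L d)) (_ : P ∈ 𝓜) => sampleLaw P n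
        {w | ENNReal.ofReal (1 * √(h n ^ d)) < supOn (𝒳 ×ˢ 𝒯) fun x τ =>
          |r n j * ((vhat n j w x τ - v P n j x τ) / sigmahat n j w x τ) -
            √(n * h n ^ d) * (gHat β h P n j w x τ -
              ∫ w', gHat β h P n j w' x τ ∂(sampleLaw P n))|}) P hP))
    intro w hw
    by_contra hcon
    rw [Set.mem_union, not_or, Set.mem_compl_iff, not_not, Set.mem_ofPred_eq, not_lt, one_mul,
      supOn_le_ofReal_iff (Real.sqrt_nonneg _)] at hcon
    rw [Set.mem_ofPred_eq] at hw
    refine absurd hw (not_lt.2 ?_)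
    rw [supOn_le_ofReal_iff (by positivity)]
    intro s hs
    exact hbound (hcon.2 s hs) ((hWg w hcon.1).1 s hs) hsn
  · intro hB1 _ j
    obtain ⟨M, hM, ρ, hρ, hev⟩ := hgood j
    intro a ha
    refine ⟨M + 1, by positivity, ?_⟩
    -- Half of the conditional probability `a` goes to the linearization error and half to the
    -- process; `a' ≤ 1` keeps `a' * √(h n ^ d)` below `√(log n)`.
    set a' := min (a / 2) 1 with ha'
    have ha'0 : 0 < a' := lt_min (by positivity) one_pos
    have hlin := tendsto_zero_of_limsup_eq_zero (hB1 j a' ha'0)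
    have hsum := hρ.add hlin
    rw [add_zero] at hsum
    refine lt_of_eq_of_lt (Tendsto.limsup_eq ?_) (ENNReal.ofReal_pos.2 ha)
    refine tendsto_of_tendsto_of_tendsto_of_le_of_le' tendsto_const_nhds hsum
      (Eventually.of_forall fun _ => zero_le) ?_
    filter_upwards [hev, hsmall, hρ.eventually_le_const
      (ENNReal.ofReal_pos.2 (show 0 < a / 2 by positivity))] with n hn hsn hρn
    refine iSup₂_le fun P hP => ?_
    obtain ⟨W, hW, hWg⟩ := hn P hP
    refine le_trans (le_trans (measure_mono ?_) (measure_union_le _ _)) (add_le_add hW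
      (le_iSup₂ (f := fun (P : ProbabilityMeasure (Obs J L d)) (_ : P ∈ 𝓜) => sampleLaw P n
        {w | ENNReal.ofReal a' < bootLaw n {κ | ENNReal.ofReal (a' * √(h n ^ d)) <
          supOn (𝒳 ×ˢ 𝒯) fun x τ =>
            |r n j * ((vstar n j w (w ∘ κ) x τ - vhat n j w x τ) / sigmastar n j w (w ∘ κ) x τ) -
              √(n * h n ^ d) * (gHat β h P n j (w ∘ κ) x τ -
                ∫ κ', gHat β h P n j (w ∘ κ') x τ ∂(bootLaw n))|}}) P hP))
    intro w hw
    by_contra hcon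
    rw [Set.mem_union, not_or, Set.mem_compl_iff, not_not, Set.mem_ofPred_eq, not_lt] at hcon
    rw [Set.mem_ofPred_eq] at hw
    refine absurd hw (not_lt.2 ?_)
    have hsplit : ENNReal.ofReal a = ENNReal.ofReal (a / 2) + ENNReal.ofReal (a / 2) := by
      rw [← ENNReal.ofReal_add (by positivity) (by positivity), add_halves]
    rw [hsplit]
    refine le_trans (le_trans (measure_mono ?_) (measure_union_le _ _)) (add_le_add
      ((hWg w hcon.1).2.trans hρn)
      (hcon.2.trans (ENNReal.ofReal_le_ofReal (min_le_left _ _))))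
    intro κ hκ
    by_contra hcon'
    rw [Set.mem_union, not_or, Set.mem_ofPred_eq, Set.mem_ofPred_eq, not_lt,
      supOn_le_ofReal_iff (by positivity)] at hcon'
    rw [Set.mem_ofPred_eq] at hκ
    refine absurd hκ (not_lt.2 ?_)
    rw [supOn_le_ofReal_iff (by positivity)]
    intro s hs
    refine hbound (hcon'.2 s hs) (not_lt.1 fun hlt => hcon'.1 ⟨s, hs, hlt⟩)
      (le_trans ?_ hsn)
    exact mul_le_of_le_one_left (Real.sqrt_nonneg _) (min_le_right _ _)
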